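/- Let $Q$ be a (finite, non-empty) quiver drawn on the torus $\mathbb{T}^2$, with vertex set $I$ and edge set $E$, so that it decomposes the torus into polygonal faces. Assume that the faces are coloured blue and red in such a way that the two faces incident to any given edge have different colours, and that the edges are oriented so as to go clockwise around the blue faces (hence counterclockwise around the red faces). Let $\widetilde{Q}$ be the lift of $Q$ to the universal cover $\mathbb{R}^2$ of $\mathbb{T}^2$. All paths are oriented, and may be trivial. A broken wheel with interface $e$ is a path in $\widetilde{Q}$ obtained by removing the edge $e$ from the boundary of one of the two faces of $\widetilde{Q}$ incident to $e$. The quiver $Q$ is called shrubby if for any two paths $p \neq p'$ in $\widetilde{Q}$ with the same start and end points, at least one of $p$ and $p'$ contains a broken wheel whose interface lies in the closed region between $p$ and $p'$, that is, in the closure of the union of the bounded connected components of $\mathbb{R}^2 \setminus (p \cup p')$. A non-degenerate $R$-charge is a function $R : E \to (0,1)$ such that for every face $F$ and every vertex $i$ of $Q$ $$\sum_{e \text{ edge around } F} R(e) = 2, \qquad \sum_{e \text{ edge incident to } i} (1 - R(e)) = 2,$$ where loops at $i$ are counted twice in the second sum. Lemma. If there exists a non-degenerate $R$-charge on $Q$,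 then $Q$ is shrubby. -/

import Mathlib

universe u v

/-- A quiver with vertices `I` and arrows `E`, cellularly drawn on an oriented surface, with faces
coloured blue and red so that each arrow has a blue face on its right and a red face on its left.
It is given combinatorially: `blue e` (respectively `red e`) is the arrow that follows `e` on the
boundary of the blue (respectively red) face incident to `e`. The surface is recovered by gluing
one polygon for every cycle of `blue` and one for every cycle of `red` along the arrows. -/
structure SurfaceQuiver (I : Type u) (E : Type v) where
  src : E → I
  tgt : E → I
  blue : Equiv.Perm E
  red : Equiv.Perm E
  src_blue : ∀ e, src (blue e) = tgt e
  src_red : ∀ e, src (red e) = tgt e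

namespace SurfaceQuiver

section Basic

variable {I : Type u} {E : Type v} (Q : SurfaceQuiver I E)

/-- The blue faces are the cycles of `blue`. -/
def BlueFace : Type v := Quotient (Equiv.Perm.SameCycle.setoid Q.blue)

/-- The red faces are the cycles of `red`. -/
def RedFace : Type v := Quotient (Equiv.Perm.SameCycle.setoid Q.red)

/-- The faces of either colour. -/
def Face : Type v := Q.BlueFace ⊕ Q.RedFace

/-- The blue face incident to an arrow. -/
def blueFaceOf (e : E) : Q.Face :=
  Sum.inl (Quotient.mk (Equiv.Perm.SameCycle.setoid Q.blue) e)

/-- The red face incident to an arrow. -/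
def redFaceOf (e : E) : Q.Face :=
  Sum.inr (Quotient.mk (Equiv.Perm.SameCycle.setoid Q.red) e)

/-- The surface is a torus: the quiver is finite, non-empty and connected, every vertex is a point
of a surface (the arrows at the vertex form a single cyclic arrangement: the next outgoing arrow
after `e` is `red (blue⁻¹ e)`), and the Euler characteristic is `0`. -/
structure IsTorus : Prop where
  finite_vertices : Finite I
  finite_arrows : Finite E
  nonempty : Nonempty I
  exists_arrow : ∀ i, ∃ e, Q.src e = i
  link : ∀ e e', Q.src e = Q.src e' → (Q.red * Q.blue⁻¹).SameCycle e e'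
  connected : ∀ i j, Relation.EqvGen (fun a b => ∃ e, Q.src e = a ∧ Q.tgt e = b) i j
  euler : (Nat.card I : ℤ) - Nat.card E + Nat.card Q.Face = 0

open Classical in
/-- A non-degenerate `R`-charge. In the sum over the arrows incident to a vertex, loops count
twice. -/
structure IsNondegenerateRCharge [Fintype E] (R : E → ℝ) : Prop where
  pos : ∀ e, 0 < R e
  lt_one : ∀ e, R e < 1
  blue_face : ∀ F : Q.BlueFace,
    ∑ e with Quotient.mk (Equiv.Perm.SameCycle.setoid Q.blue) e = F, R e = 2
  red_face : ∀ F : Q.RedFace,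
    ∑ e with Quotient.mk (Equiv.Perm.SameCycle.setoid Q.red) e = F, R e = 2
  vertex : ∀ i, ∑ e with Q.src e = i, (1 - R e) + ∑ e with Q.tgt e = i, (1 - R e) = 2

/-- The cycle of arrows of the permutation `σ` through `e`, listed from `e` on. For `σ = blue` or
`σ = red` it is the boundary of a face. -/
noncomputable def boundary (σ : Equiv.Perm E) (e : E) : List E :=
  (List.range (Function.minimalPeriod σ e)).map fun k => (σ ^ k) e

/-- `Q.IsPath i p j`: the arrows in the list `p` form an oriented path from `i` to `j`. -/
def IsPath : I → List E → I → Prop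
  | i, [], j => i = j
  | i, e :: p, j => Q.src e = i ∧ IsPath (Q.tgt e) p j

/-- The oriented path `p`, which starts at `i`, contains a broken wheel with interface `e`, i.e.
the path from `tgt e` to `src e` obtained by removing `e` from the boundary of one of the two
faces incident to `e`. -/
def ContainsBrokenWheel (i : I) (p : List E) (e : E) : Prop :=
  ∃ a w b : List E, (w = (boundary Q.blue e).tail ∨ w = (boundary Q.red e).tail) ∧
    p = a ++ w ++ b ∧ Q.IsPath i a (Q.tgt e)

/-- Two faces share an arrow that does not belong to `S`. -/
def FaceAdj (S : Set E) (F G : Q.Face) : Prop :=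
  ∃ e, e ∉ S ∧ ((Q.blueFaceOf e = F ∧ Q.redFaceOf e = G) ∨
    (Q.redFaceOf e = F ∧ Q.blueFaceOf e = G))

/-- For `Q` drawn on the plane and a finite set `S` of arrows: the face `F` lies in a bounded
connected component of the complement of the arrows of `S`, i.e. only finitely many faces can be
reached from `F` without crossing `S`. -/
def Encloses (S : Set E) (F : Q.Face) : Prop :=
  {G | Relation.ReflTransGen (Q.FaceAdj S) F G}.Finite

/-- The arrow `e` lies in the closed region between `p` and `p'`, i.e. in the closure of the union
of the bounded connected components of the complement of `p` and `p'`. -/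
def InRegion (p p' : List E) (e : E) : Prop :=
  Q.Encloses {x | x ∈ p ∨ x ∈ p'} (Q.blueFaceOf e) ∨
    Q.Encloses {x | x ∈ p ∨ x ∈ p'} (Q.redFaceOf e)

end Basic

/-! The universal cover, built from homotopy classes of unoriented walks. -/

section Cover

variable {I : Type u} {E : Type v} (Q : SurfaceQuiver I E)

/-- The start of a signed arrow: `(e, true)` runs along `e`, and `(e, false)` against it. -/
def stepStart (x : E × Bool) : I := if x.2 then Q.src x.1 else Q.tgt x.1

/-- The end of a signed arrow. -/
def stepEnd (x : E × Bool) : I := if x.2 then Q.tgt x.1 else Q.src x.1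

/-- A signed arrow run backwards. -/
def stepInv (x : E × Bool) : E × Bool := (x.1, !x.2)

/-- `Q.IsWalk i w j`: the signed arrows in `w` form an unoriented walk from `i` to `j`. -/
def IsWalk : I → List (E × Bool) → I → Prop
  | i, [], j => i = j
  | i, x :: w, j => Q.stepStart x = i ∧ IsWalk (Q.stepEnd x) w j

/-- The unoriented walks from `i` to `j`. -/
def Walk (i j : I) : Type v := {w : List (E × Bool) // Q.IsWalk i w j}

/-- The elementary homotopies: insertion of a signed arrow followed by its inverse, and insertion
of the boundary of a face. -/
inductive Elementary : List (E × Bool) → List (E × Bool) → Prop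
  | cancel (a b : List (E × Bool)) (x : E × Bool) :
      Elementary (a ++ b) (a ++ [x, stepInv x] ++ b)
  | blue (a b : List (E × Bool)) (e : E) :
      Elementary (a ++ b) (a ++ (boundary Q.blue e).map (fun f => (f, true)) ++ b)
  | red (a b : List (E × Bool)) (e : E) :
      Elementary (a ++ b) (a ++ (boundary Q.red e).map (fun f => (f, true)) ++ b)

/-- Homotopy classes, with fixed end points, of walks from `i` to `j`. -/
def HomotopyClass (i j : I) : Type v :=
  Quot fun w w' : Q.Walk i j => Q.Elementary w.1 w'.1

variable {Q} in
theorem IsWalk.concat {x : E × Bool} {j : I} :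
    ∀ {w : List (E × Bool)} {i : I}, Q.IsWalk i w j → Q.stepStart x = j →
      Q.IsWalk i (w ++ [x]) (Q.stepEnd x)
  | [], _, h, hx => ⟨hx.trans (Eq.symm h), rfl⟩
  | _ :: _, _, h, hx => ⟨h.1, IsWalk.concat h.2 hx⟩

variable {Q} in
theorem Elementary.concat {w w' : List (E × Bool)} (x : E × Bool) (h : Q.Elementary w w') :
    Q.Elementary (w ++ [x]) (w' ++ [x]) := by
  cases h with
  | cancel a b y => simpa using Elementary.cancel (Q := Q) a (b ++ [x]) y
  | blue a b e => simpa using Elementary.blue (Q := Q) a (b ++ [x]) e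
  | red a b e => simpa using Elementary.red (Q := Q) a (b ++ [x]) e

/-- The vertices of the universal cover based at `o`, lying over the vertices of `Q`. -/
def CoverVertex (o : I) : Type (max u v) := Σ i, Q.HomotopyClass o i

/-- Extend the homotopy class of a walk by a signed arrow. -/
def CoverVertex.extend {o : I} (a : Q.CoverVertex o) (x : E × Bool)
    (h : Q.stepStart x = a.1) : Q.CoverVertex o :=
  ⟨Q.stepEnd x, Quot.map (fun w : Q.Walk o a.1 =>
      (⟨w.1 ++ [x], w.2.concat h⟩ : Q.Walk o (Q.stepEnd x)))
    (fun _ _ hw => Elementary.concat x hw) a.2⟩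

theorem CoverVertex.extend_extend {o : I} (a : Q.CoverVertex o) (x : E × Bool)
    (h : Q.stepStart x = a.1) (h' : Q.stepStart (stepInv x) = (CoverVertex.extend Q a x h).1) :
    CoverVertex.extend Q (CoverVertex.extend Q a x h) (stepInv x) h' = a := by
  obtain ⟨i, γ⟩ := a
  have hi : Q.stepEnd (stepInv x) = i := by
    refine Eq.trans ?_ h
    obtain ⟨e, b⟩ := x
    cases b <;> rfl
  subst hi
  induction γ using Quot.ind with
  | mk w =>
    refine congrArg (Sigma.mk (β := fun i => Q.HomotopyClass o i) _) (Quot.sound ?_).symm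
    simpa using Elementary.cancel (Q := Q) w.1 [] x

/-- The arrows of the universal cover: an arrow of `Q` with a vertex of the universal cover over
its source. -/
def CoverArrow (o : I) : Type (max u v) := {x : E × Q.CoverVertex o // x.2.1 = Q.src x.1}

/-- The end point of an arrow of the universal cover. -/
def CoverArrow.target {o : I} (x : Q.CoverArrow o) : Q.CoverVertex o :=
  CoverVertex.extend Q x.1.2 (x.1.1, true) x.2.symm

/-- The lift of `blue` or `red` to the arrows of the universal cover. -/
def liftPerm (σ : Equiv.Perm E) (hσ : ∀ e, Q.src (σ e) = Q.tgt e) (o : I) :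
    Equiv.Perm (Q.CoverArrow o) where
  toFun x := ⟨(σ x.1.1, CoverArrow.target Q x), (hσ x.1.1).symm⟩
  invFun x := ⟨(σ.symm x.1.1, CoverVertex.extend Q x.1.2 (σ.symm x.1.1, false)
    (by rw [x.2]; exact (hσ _).symm.trans (by rw [σ.apply_symm_apply]))), rfl⟩
  left_inv x := by
    obtain ⟨⟨e, a⟩, h⟩ := x
    refine Subtype.ext (Prod.ext (σ.symm_apply_apply e) ?_)
    have key : ∀ e' (he : e' = e) (h' : Q.stepStart (e', false) =
        (CoverVertex.extend Q a (e, true) h.symm).1),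
        CoverVertex.extend Q (CoverVertex.extend Q a (e, true) h.symm) (e', false) h' = a := by
      rintro e' rfl h'
      exact CoverVertex.extend_extend Q a (e', true) _ h'
    exact key _ (σ.symm_apply_apply e) (congrArg Q.tgt (σ.symm_apply_apply e))
  right_inv x := by
    obtain ⟨⟨e, a⟩, h⟩ := x
    refine Subtype.ext (Prod.ext (σ.apply_symm_apply e) ?_)
    have h' : Q.tgt (σ.symm e) = a.1 := by
      rw [← hσ, σ.apply_symm_apply]
      exact h.symm
    exact CoverVertex.extend_extend Q a (σ.symm e, false) h' rfl

/-- The universal cover of `Q`, based at the vertex `o`. -/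
def cover (o : I) : SurfaceQuiver (Q.CoverVertex o) (Q.CoverArrow o) where
  src x := x.1.2
  tgt x := CoverArrow.target Q x
  blue := Q.liftPerm Q.blue Q.src_blue o
  red := Q.liftPerm Q.red Q.src_red o
  src_blue _ := rfl
  src_red _ := rfl

/-- `Q` is shrubby: of any two distinct paths `p`, `p'` in the universal cover with the same start
and end points, at least one contains a broken wheel whose interface lies in the closed region
between `p` and `p'`. -/
def IsShrubby : Prop :=
  ∀ (o : I) (a b : Q.CoverVertex o) (p p' : List (Q.CoverArrow o)),
    (Q.cover o).IsPath a p b → (Q.cover o).IsPath a p' b → p ≠ p' →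
      ∃ e : Q.CoverArrow o,
        ((Q.cover o).ContainsBrokenWheel a p e ∨ (Q.cover o).ContainsBrokenWheel a p' e) ∧
          (Q.cover o).InRegion p p' e

end Cover

end SurfaceQuiver

/-!
# Quivers with a non-degenerate `R`-charge are shrubby

Two distinct paths with the same end points in the universal cover have distinct subpaths `p`, `p'`
with common end points that meet in their end points only, so that `p * p'⁻¹` is a simple closed
curve (`IsMinimalPair.simplePair`). Shrinking the paths shrinks the region between them, so it
suffices to find a broken wheel for such a pair.

*The region.* The universal cover has no first homology (`cover_exact`): the class of the lift of a
walk modulo boundaries depends only on the homotopy class of the walk, hence defines a potential on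
the vertices whose differences are the classes of the arrows. So the curve bounds a `2`-chain, whose
coefficients are winding numbers. The two sides of the curve are connected and exhaust all faces, so
that a side on which the winding number is not zero is a finite set `D` of faces with connected
complement (`SimplePair.exists_region`), and all faces in `D` are enclosed by the curve.

*Gauss-Bonnet.* The closure of `D` again has no first homology, so its Euler characteristic is at
least `1` (`IsPlanar.one_le_euler`). Summing the conditions on the charge over the faces in `D` and
over the vertices in its interior turns this into the inequality `IsPlanar.gauss_bonnet`: the charge
of the curve is at least `2` plus the sum of `1 - R e` over all ends, at vertices of the curve, of
arrows `e` inside the region.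

*Upper bound.* Say that `p` has red faces of `D` next to it. If `p` misses at least two arrows of a
red face that it meets, the charge of the arrows of this face on `p` is `2` minus that of the
others, hence at most `(1 - R g) + (1 - R h)` for an arrow `g` that follows a piece of `p` on this
face and another arrow `h` that precedes one. These ends lie inside the region, and adding up over
all faces along `p` and `p'` counts every end once, except possibly one at each end point of the
paths (`SimplePair.sum_lt`). So the charge of the curve would be less than allowed by the
Gauss-Bonnet inequality. Therefore one of the paths contains all arrows of a face in `D` except at
most one, `g`, and then it contains the broken wheel with interface `g` of this face
(`exists_broken_wheel`). If one of the paths is trivial, the other one is closed and may run through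
a broken wheel across its base point; this happens for one face only and costs less than `2` in the
estimate (`sum_lt_of_isPath_closed`).
-/

namespace SurfaceQuiver

/-! ### Cycles of a permutation with total weight two -/

section Cycles

open Function Classical

variable {A : Type*} {σ : Equiv.Perm A} {R : A → ℝ}

/-- Every cycle of `σ` is finite and has total weight `2`. A point on an infinite cycle has minimal
period `0`, so the sum attached to it is empty and the condition fails. -/
def HasCycleSum (σ : Equiv.Perm A) (R : A → ℝ) : Prop :=
  ∀ e, ∑ k ∈ Finset.range (minimalPeriod σ e), R ((σ ^ k) e) = 2

theorem HasCycleSum.period_pos (h : HasCycleSum σ R) (e : A) : 0 < minimalPeriod σ e := by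
  rcases Nat.eq_zero_or_pos (minimalPeriod σ e) with h0 | h0
  · have := h e
    rw [h0] at this
    norm_num at this
  · exact h0

theorem HasCycleSum.two_lt_period (h : HasCycleSum σ R) (hlt : ∀ e, R e < 1) (e : A) :
    2 < minimalPeriod σ e := by
  by_contra hc
  have h1 := h e
  have h2 : ∑ k ∈ Finset.range (minimalPeriod σ e), R ((σ ^ k) e) <
      ∑ k ∈ Finset.range (minimalPeriod σ e), (1 : ℝ) :=
    Finset.sum_lt_sum_of_nonempty ⟨0, Finset.mem_range.2 (h.period_pos e)⟩ fun _ _ => hlt _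
  simp only [Finset.sum_const, Finset.card_range, nsmul_eq_mul, mul_one] at h2
  have h3 : ((minimalPeriod σ e : ℕ) : ℝ) ≤ 2 := by exact_mod_cast not_lt.1 hc
  linarith

theorem pow_minimalPeriod_apply (σ : Equiv.Perm A) (e : A) : (σ ^ minimalPeriod σ e) e = e := by
  rw [← Equiv.Perm.iterate_eq_pow]
  exact iterate_minimalPeriod

theorem exists_pow_lt_of_sameCycle {e f : A} (h0 : 0 < minimalPeriod σ e)
    (h : σ.SameCycle e f) : ∃ k < minimalPeriod σ e, (σ ^ k) e = f := by
  obtain ⟨i, hi⟩ := h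
  have h1 : (σ ^ (i % (minimalPeriod σ e : ℤ))) e = (σ ^ i) e :=
    MulAction.zpow_smul_mod_minimalPeriod σ e i
  have hN : (0 : ℤ) < minimalPeriod σ e := by exact_mod_cast h0
  obtain ⟨k, hk⟩ := Int.eq_ofNat_of_zero_le (Int.emod_nonneg i hN.ne')
  have hk' := Int.emod_lt_of_pos i hN
  rw [hk] at h1 hk'
  exact ⟨k, by exact_mod_cast hk', by rw [← hi, ← h1]; rfl⟩

theorem sameCycle_pow (σ : Equiv.Perm A) (k : ℕ) (e : A) : σ.SameCycle e ((σ ^ k) e) :=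
  ⟨k, by simp⟩

theorem mem_boundary {e f : A} (h0 : 0 < minimalPeriod σ e) :
    f ∈ boundary σ e ↔ σ.SameCycle e f := by
  simp only [boundary, List.mem_map, List.mem_range]
  constructor
  · rintro ⟨k, -, rfl⟩
    exact sameCycle_pow σ k e
  · intro h
    obtain ⟨k, hk, hf⟩ := exists_pow_lt_of_sameCycle h0 h
    exact ⟨k, hk, hf⟩

theorem pow_injOn_period (σ : Equiv.Perm A) (e : A) :
    Set.InjOn (fun k : ℕ => (σ ^ k) e) (Set.Iio (minimalPeriod σ e)) := by
  have := iterate_injOn_Iio_minimalPeriod (f := σ) (x := e)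
  simpa only [Equiv.Perm.iterate_eq_pow] using this

theorem nodup_boundary (σ : Equiv.Perm A) (e : A) : (boundary σ e).Nodup := by
  refine List.Nodup.map_on ?_ List.nodup_range
  intro x hx y hy hxy
  exact pow_injOn_period σ e (List.mem_range.1 hx) (List.mem_range.1 hy) hxy

theorem sum_boundary_toFinset (σ : Equiv.Perm A) (R : A → ℝ) (e : A) :
    ∑ x ∈ (boundary σ e).toFinset, R x =
      ∑ k ∈ Finset.range (minimalPeriod σ e), R ((σ ^ k) e) := by
  rw [List.sum_toFinset _ (nodup_boundary σ e), boundary, List.map_map,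
    Finset.sum_range, ← List.sum_ofFn, List.ofFn_eq_map, ← List.map_coe_finRange_eq_range,
    List.map_map]
  rfl

theorem HasCycleSum.sum_boundary (h : HasCycleSum σ R) (e : A) :
    ∑ x ∈ (boundary σ e).toFinset, R x = 2 :=
  (sum_boundary_toFinset σ R e).trans (h e)

theorem HasCycleSum.mem_boundary_toFinset (h : HasCycleSum σ R) {e f : A} :
    f ∈ (boundary σ e).toFinset ↔ σ.SameCycle e f := by
  rw [List.mem_toFinset, mem_boundary (h.period_pos e)]

/-- Going along a cycle from outside a set to inside it, there is a point of entrance. -/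
theorem exists_entrance {P : Finset A} {x y : A} (h0 : 0 < minimalPeriod σ x)
    (hxy : σ.SameCycle x y) (hx : x ∉ P) (hy : y ∈ P) :
    ∃ z, σ.SameCycle x z ∧ z ∉ P ∧ σ z ∈ P := by
  obtain ⟨k, -, rfl⟩ := exists_pow_lt_of_sameCycle h0 hxy
  clear hxy
  induction k with
  | zero => exact absurd hy hx
  | succ k ih =>
    by_cases hk : (σ ^ k) x ∈ P
    · exact ih hk
    · exact ⟨_, sameCycle_pow σ k x, hk, by rwa [pow_succ', Equiv.Perm.mul_apply] at hy⟩

/-- Going along a cycle from inside a set to outside it, there is a point of exit. -/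
theorem exists_exit {P : Finset A} {x y : A} (h0 : 0 < minimalPeriod σ x)
    (hxy : σ.SameCycle x y) (hx : x ∈ P) (hy : y ∉ P) :
    ∃ z, σ.SameCycle x z ∧ z ∈ P ∧ σ z ∉ P := by
  obtain ⟨k, -, rfl⟩ := exists_pow_lt_of_sameCycle h0 hxy
  clear hxy
  induction k with
  | zero => exact absurd hx hy
  | succ k ih =>
    by_cases hk : (σ ^ k) x ∈ P
    · exact ⟨_, sameCycle_pow σ k x, hk, by rwa [pow_succ', Equiv.Perm.mul_apply] at hy⟩
    · exact ih hk

/-- The points outside `P` that come just after a point of `P`. -/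
noncomputable def exits (σ : Equiv.Perm A) (P : Finset A) : Finset A := P.image σ \ P

/-- The points outside `P` that come just before a point of `P`. -/
noncomputable def entrances (σ : Equiv.Perm A) (P : Finset A) : Finset A := P.image σ.symm \ P

theorem mem_exits {P : Finset A} {x : A} : x ∈ exits σ P ↔ (∃ y ∈ P, σ y = x) ∧ x ∉ P := by
  simp [exits]

theorem mem_entrances {P : Finset A} {x : A} : x ∈ entrances σ P ↔ σ x ∈ P ∧ x ∉ P := by
  simp only [entrances, Finset.mem_sdiff, Finset.mem_image]
  refine and_congr_left fun _ => ⟨?_, fun h => ⟨_, h, σ.symm_apply_apply x⟩⟩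
  rintro ⟨y, hy, rfl⟩
  simpa using hy

/-- If `P` meets a cycle and misses two of its points, then an exit and an entrance can be found
that differ: otherwise `P` together with the only exit would be the whole cycle. -/
theorem exists_exit_ne_entrance {P : Finset A} {e y y' : A} (h0 : ∀ x, 0 < minimalPeriod σ x)
    (he : e ∈ P) (hy : σ.SameCycle e y) (hy' : σ.SameCycle e y') (hne : y ≠ y') (hyP : y ∉ P)
    (hyP' : y' ∉ P) :
    ∃ g h, σ.SameCycle e g ∧ σ.SameCycle e h ∧ g ∈ exits σ P ∧ h ∈ entrances σ P ∧ g ≠ h := by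
  by_contra! hcon
  obtain ⟨z, hz, hzP, hzP'⟩ := exists_exit (h0 e) hy he hyP
  obtain ⟨h, hh, hhP, hhP'⟩ := exists_entrance (h0 y) hy.symm hyP he
  have hexit : ∀ x, σ.SameCycle e x → x ∈ P → σ x ∉ P → σ x = h := fun x hx hxP hxP' =>
    hcon _ _ (hx.trans ⟨1, rfl⟩) (hy.trans hh) (mem_exits.2 ⟨⟨x, hxP, rfl⟩, hxP'⟩)
      (mem_entrances.2 ⟨hhP', hhP⟩)
  have hall : ∀ k : ℕ, (σ ^ k) e ∈ P ∨ (σ ^ k) e = h := by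
    intro k
    induction k with
    | zero => exact Or.inl he
    | succ k ih =>
      rw [pow_succ', Equiv.Perm.mul_apply]
      rcases ih with ih | ih
      · by_cases hk : σ ((σ ^ k) e) ∈ P
        · exact Or.inl hk
        · exact Or.inr (hexit _ (sameCycle_pow σ k e) ih hk)
      · rw [ih]
        exact Or.inl hhP'
  obtain ⟨k, -, hk⟩ := exists_pow_lt_of_sameCycle (h0 e) hy
  obtain ⟨k', -, hk'⟩ := exists_pow_lt_of_sameCycle (h0 e) hy'
  have h1 := hall k
  have h2 := hall k'
  rw [hk] at h1
  rw [hk'] at h2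
  exact hne ((h1.resolve_left hyP).trans (h2.resolve_left hyP').symm)

/-- The cycle of `σ` through `e`. -/
abbrev cyc (σ : Equiv.Perm A) (e : A) : Quotient (Equiv.Perm.SameCycle.setoid σ) :=
  Quotient.mk (Equiv.Perm.SameCycle.setoid σ) e

theorem cyc_eq_iff {e f : A} : cyc σ e = cyc σ f ↔ σ.SameCycle e f :=
  ⟨fun h => Quotient.exact h, fun h => Quotient.sound h⟩

theorem cyc_apply (σ : Equiv.Perm A) (e : A) : cyc σ (σ e) = cyc σ e :=
  (cyc_eq_iff.2 ⟨1, rfl⟩).symm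

theorem HasCycleSum.sum_cyc_inter_add (h : HasCycleSum σ R) (P : Finset A) (e : A) :
    ∑ x ∈ P with cyc σ x = cyc σ e, R x + ∑ x ∈ (boundary σ e).toFinset \ P, R x = 2 := by
  rw [← h.sum_boundary e, ← Finset.sum_inter_add_sum_sdiff (boundary σ e).toFinset P]
  congr 2
  ext x
  rw [Finset.mem_filter, Finset.mem_inter, h.mem_boundary_toFinset, cyc_eq_iff,
    Equiv.Perm.sameCycle_comm, and_comm]

/-- The bound on one cycle: a part of a cycle that misses two of its points weighs at most as much
as the defects `1 - R` of its exits and entrances. -/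
theorem HasCycleSum.sum_cyc_le (h : HasCycleSum σ R) (hpos : ∀ e, 0 < R e) (hlt : ∀ e, R e < 1)
    {P : Finset A} {e y y' : A} (he : e ∈ P) (hy : σ.SameCycle e y) (hy' : σ.SameCycle e y')
    (hne : y ≠ y') (hyP : y ∉ P) (hyP' : y' ∉ P) :
    ∑ x ∈ P with cyc σ x = cyc σ e, R x ≤
      ∑ x ∈ exits σ P with cyc σ x = cyc σ e, (1 - R x) +
        ∑ x ∈ entrances σ P with cyc σ x = cyc σ e, (1 - R x) := by
  obtain ⟨g, k, hg, hk, hgP, hkP, hgk⟩ :=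
    exists_exit_ne_entrance h.period_pos he hy hy' hne hyP hyP'
  have h1 := h.sum_cyc_inter_add P e
  have h2 : R g + R k ≤ ∑ x ∈ (boundary σ e).toFinset \ P, R x := by
    rw [← Finset.sum_pair hgk]
    refine Finset.sum_le_sum_of_subset_of_nonneg ?_ fun x _ _ => (hpos x).le
    intro x hx
    rw [Finset.mem_insert, Finset.mem_singleton] at hx
    rw [Finset.mem_sdiff, h.mem_boundary_toFinset]
    rcases hx with rfl | rfl
    · exact ⟨hg, (mem_exits.1 hgP).2⟩
    · exact ⟨hk, (mem_entrances.1 hkP).2⟩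
  have h3 : 1 - R g ≤ ∑ x ∈ exits σ P with cyc σ x = cyc σ e, (1 - R x) :=
    Finset.single_le_sum (f := fun x => 1 - R x) (fun x _ => (sub_pos.2 (hlt x)).le)
      (Finset.mem_filter.2 ⟨hgP, cyc_eq_iff.2 hg.symm⟩)
  have h4 : 1 - R k ≤ ∑ x ∈ entrances σ P with cyc σ x = cyc σ e, (1 - R x) :=
    Finset.single_le_sum (f := fun x => 1 - R x) (fun x _ => (sub_pos.2 (hlt x)).le)
      (Finset.mem_filter.2 ⟨hkP, cyc_eq_iff.2 hk.symm⟩)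
  linarith

/-- If `P` misses at least two points of every cycle that it meets, the bounds on the single cycles
add up. -/
theorem HasCycleSum.sum_le_of_missing (h : HasCycleSum σ R) (hpos : ∀ e, 0 < R e)
    (hlt : ∀ e, R e < 1) {P : Finset A}
    (hP : ∀ e ∈ P, ∃ y y', σ.SameCycle e y ∧ σ.SameCycle e y' ∧ y ≠ y' ∧ y ∉ P ∧ y' ∉ P) :
    ∑ x ∈ P, R x ≤ ∑ x ∈ exits σ P, (1 - R x) + ∑ x ∈ entrances σ P, (1 - R x) := by
  have hmaps : ∀ x ∈ P, cyc σ x ∈ P.image (cyc σ) := fun x hx => Finset.mem_image_of_mem _ hx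
  have hout : ∀ x ∈ exits σ P, cyc σ x ∈ P.image (cyc σ) := by
    intro x hx
    obtain ⟨⟨y, hy, rfl⟩, -⟩ := mem_exits.1 hx
    rw [cyc_apply]
    exact hmaps y hy
  have hin : ∀ x ∈ entrances σ P, cyc σ x ∈ P.image (cyc σ) := by
    intro x hx
    rw [← cyc_apply]
    exact hmaps _ (mem_entrances.1 hx).1
  rw [← Finset.sum_fiberwise_of_maps_to hmaps, ← Finset.sum_fiberwise_of_maps_to hout,
    ← Finset.sum_fiberwise_of_maps_to hin, ← Finset.sum_add_distrib]
  refine Finset.sum_le_sum fun F hF => ?_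
  obtain ⟨e, he, rfl⟩ := Finset.mem_image.1 hF
  obtain ⟨y, y', hy, hy', hne, hyP, hyP'⟩ := hP e he
  exact h.sum_cyc_le hpos hlt he hy hy' hne hyP hyP'

/-- If there is one exceptional cycle of which `P` may miss a single point only, the bound holds up
to a loss smaller than `2`. -/
theorem HasCycleSum.sum_lt_of_missing (h : HasCycleSum σ R) (hpos : ∀ e, 0 < R e)
    (hlt : ∀ e, R e < 1) {P : Finset A} {e₀ g₀ : A} (hg : σ.SameCycle e₀ g₀) (hg₀ : g₀ ∉ P)
    (hP : ∀ e ∈ P, ¬ σ.SameCycle e₀ e →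
      ∃ y y', σ.SameCycle e y ∧ σ.SameCycle e y' ∧ y ≠ y' ∧ y ∉ P ∧ y' ∉ P) :
    ∑ x ∈ P, R x < 2 + ∑ x ∈ exits σ P, (1 - R x) + ∑ x ∈ entrances σ P, (1 - R x) := by
  set P' := P.filter fun x => ¬ cyc σ x = cyc σ e₀ with hP'
  have hmem : ∀ x, x ∈ P' ↔ x ∈ P ∧ ¬ σ.SameCycle e₀ x := fun x => by
    rw [hP', Finset.mem_filter, cyc_eq_iff, Equiv.Perm.sameCycle_comm]
  have h1 : ∑ x ∈ P', R x ≤ ∑ x ∈ exits σ P', (1 - R x) + ∑ x ∈ entrances σ P', (1 - R x) := by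
    refine h.sum_le_of_missing hpos hlt fun e he => ?_
    obtain ⟨y, y', hy, hy', hne, hyP, hyP'⟩ := hP e ((hmem e).1 he).1 ((hmem e).1 he).2
    exact ⟨y, y', hy, hy', hne, fun hc => hyP ((hmem y).1 hc).1, fun hc => hyP' ((hmem y').1 hc).1⟩
  have h2 : ∑ x ∈ exits σ P', (1 - R x) ≤ ∑ x ∈ exits σ P, (1 - R x) := by
    refine Finset.sum_le_sum_of_subset_of_nonneg ?_ fun x _ _ => (sub_pos.2 (hlt x)).le
    intro x hx
    obtain ⟨⟨y, hy, rfl⟩, hx'⟩ := mem_exits.1 hx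
    rw [hmem] at hy
    refine mem_exits.2 ⟨⟨y, hy.1, rfl⟩, fun hc => hx' ((hmem _).2 ⟨hc, fun hc' => hy.2 ?_⟩)⟩
    exact (Equiv.Perm.sameCycle_apply_right).1 hc'
  have h3 : ∑ x ∈ entrances σ P', (1 - R x) ≤ ∑ x ∈ entrances σ P, (1 - R x) := by
    refine Finset.sum_le_sum_of_subset_of_nonneg ?_ fun x _ _ => (sub_pos.2 (hlt x)).le
    intro x hx
    obtain ⟨hy, hx'⟩ := mem_entrances.1 hx
    rw [hmem] at hy
    refine mem_entrances.2 ⟨hy.1, fun hc => hx' ((hmem _).2 ⟨hc, fun hc' => hy.2 ?_⟩)⟩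
    exact (Equiv.Perm.sameCycle_apply_right).2 hc'
  have h4 := h.sum_cyc_inter_add P e₀
  have h5 : R g₀ ≤ ∑ x ∈ (boundary σ e₀).toFinset \ P, R x :=
    Finset.single_le_sum (f := R) (fun x _ => (hpos x).le)
      (Finset.mem_sdiff.2 ⟨h.mem_boundary_toFinset.2 hg, hg₀⟩)
  have h6 := Finset.sum_filter_add_sum_filter_not P (fun x => cyc σ x = cyc σ e₀) R
  have := hpos g₀
  linarith

end Cycles

end SurfaceQuiver

namespace SurfaceQuiver

/-! ### Paths and broken wheels -/

section Paths

open Function Classical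

variable {V : Type u} {A : Type v} {X : SurfaceQuiver V A} {R : A → ℝ}

theorem isPath_append {p q : List A} {i j : V} :
    X.IsPath i (p ++ q) j ↔ ∃ k, X.IsPath i p k ∧ X.IsPath k q j := by
  induction p generalizing i with
  | nil => simp [IsPath]
  | cons e p ih =>
    simp only [List.cons_append, IsPath, ih]
    constructor
    · rintro ⟨h, k, h1, h2⟩
      exact ⟨k, ⟨h, h1⟩, h2⟩
    · rintro ⟨k, ⟨h, h1⟩, h2⟩
      exact ⟨h, k, h1, h2⟩

theorem IsPath.split {u w : List A} {e : A} {i j : V} (h : X.IsPath i (u ++ e :: w) j) :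
    X.IsPath i u (X.src e) ∧ X.IsPath (X.tgt e) w j := by
  obtain ⟨k, h1, h2, h3⟩ := isPath_append.1 h
  subst h2
  exact ⟨h1, h3⟩

theorem IsPath.concat {u : List A} {e : A} {i : V} (h : X.IsPath i u (X.src e)) :
    X.IsPath i (u ++ [e]) (X.tgt e) :=
  isPath_append.2 ⟨_, h, rfl, rfl⟩

theorem IsPath.tgt_eq_or {p : List A} {i j : V} (h : X.IsPath i p j) {e : A} (he : e ∈ p) :
    X.tgt e = j ∨ ∃ f ∈ p, X.src f = X.tgt e := by
  obtain ⟨u, w, rfl⟩ := List.append_of_mem he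
  have h1 := h.split.2
  cases w with
  | nil => exact Or.inl h1
  | cons f w => exact Or.inr ⟨f, by simp, h1.1⟩

/-- A path without repeated starting vertices that contains all arrows of a cycle of `σ` except
possibly `g`, and that does not end inside the cycle, runs through the cycle without interruption:
it contains the broken wheel with interface `g`. -/
theorem exists_broken_wheel {σ : Equiv.Perm A} (hσ : ∀ e, X.src (σ e) = X.tgt e) {p : List A}
    {a b : V} (hp : X.IsPath a p b) (hnd : (p.map X.src).Nodup) {g : A}
    (hN : 2 < minimalPeriod σ g) (hmem : ∀ y, σ.SameCycle g y → y ≠ g → y ∈ p)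
    (hb : ∀ k, 2 ≤ k → k < minimalPeriod σ g → X.src ((σ ^ k) g) ≠ b) :
    ∃ u w, p = u ++ (boundary σ g).tail ++ w := by
  have hin : ∀ k, 1 ≤ k → k < minimalPeriod σ g → (σ ^ k) g ∈ p := by
    intro k hk hkN
    refine hmem _ (sameCycle_pow σ k g) fun hc => ?_
    have := pow_injOn_period σ g (Set.mem_Iio.2 hkN) (Set.mem_Iio.2 (by omega : 0 < _)) hc
    omega
  have key : ∀ m, m + 2 ≤ minimalPeriod σ g →
      ∃ u w, p = u ++ (List.range (m + 1)).map (fun k => (σ ^ (k + 1)) g) ++ w := by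
    intro m
    induction m with
    | zero =>
      intro hm
      obtain ⟨u, w, h⟩ := List.append_of_mem (hin 1 le_rfl (by omega))
      exact ⟨u, w, by simpa using h⟩
    | succ m ih =>
      intro hm
      obtain ⟨u, w, h⟩ := ih (by omega)
      have hnext := hin (m + 2) (by omega) (by omega)
      have hsrc : X.src ((σ ^ (m + 2)) g) = X.tgt ((σ ^ (m + 1)) g) := by
        rw [pow_succ', Equiv.Perm.mul_apply, hσ]
      rw [List.range_succ, List.map_append] at h
      have hw : X.IsPath (X.tgt ((σ ^ (m + 1)) g)) w b := by
        rw [h] at hp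
        refine (IsPath.split (i := a)
          (u := u ++ (List.range m).map fun k => (σ ^ (k + 1)) g) ?_).2
        simpa using hp
      cases w with
      | nil => exact absurd (hsrc.trans hw) (hb _ (by omega) (by omega))
      | cons z w =>
        have hz : z = (σ ^ (m + 2)) g := by
          refine List.inj_on_of_nodup_map hnd ?_ hnext (hw.1.trans hsrc.symm)
          rw [h]
          simp
        refine ⟨u, w, ?_⟩
        rw [h, hz, List.range_succ (n := m + 1), List.range_succ (n := m)]
        simp
  obtain ⟨u, w, h⟩ := key (minimalPeriod σ g - 2) (by omega)
  refine ⟨u, w, ?_⟩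
  rw [h, boundary]
  congr 2
  obtain ⟨n, hn⟩ : ∃ n, minimalPeriod σ g = n + 2 := ⟨_, (Nat.sub_add_cancel hN.le).symm⟩
  rw [hn, show n + 2 - 2 + 1 = n + 1 from rfl, show n + 2 = n + 1 + 1 from rfl,
    List.range_succ_eq_map (n := n + 1), List.map_cons, List.tail_cons, List.map_map]
  rfl

/-- A path that contains no broken wheel along the cycle of `e`, and does not end on this cycle,
misses two arrows of the cycle. -/
theorem exists_missing {σ : Equiv.Perm A} (hσ : ∀ e, X.src (σ e) = X.tgt e) {p : List A}
    {a b : V} (hp : X.IsPath a p b) (hnd : (p.map X.src).Nodup) {e : A}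
    (hN : ∀ e, 2 < minimalPeriod σ e)
    (hno : ∀ g, σ.SameCycle e g → ∀ u w, p ≠ u ++ (boundary σ g).tail ++ w)
    (hb : ∀ y ∈ p, σ.SameCycle e y → X.src y ≠ b) :
    ∃ y y', σ.SameCycle e y ∧ σ.SameCycle e y' ∧ y ≠ y' ∧ y ∉ p ∧ y' ∉ p := by
  by_contra! hcon
  obtain ⟨g, hg, hgp⟩ : ∃ g, σ.SameCycle e g ∧ ∀ y, σ.SameCycle e y → y ≠ g → y ∈ p := by
    by_cases hall : ∀ y, σ.SameCycle e y → y ∈ p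
    · exact ⟨e, Equiv.Perm.SameCycle.refl _ _, fun y hy _ => hall y hy⟩
    · push Not at hall
      obtain ⟨g, hg, hgp⟩ := hall
      exact ⟨g, hg, fun y hy hne => hcon g y hg hy hne.symm hgp⟩
  obtain ⟨u, w, h⟩ := exists_broken_wheel hσ hp hnd (hN g)
    (fun y hy hne => hgp y (hg.trans hy) hne) (by
      intro k hk hkN
      refine hb _ (hgp _ (hg.trans (sameCycle_pow σ k g)) fun hc => ?_)
        (hg.trans (sameCycle_pow σ k g))
      have := pow_injOn_period σ g (Set.mem_Iio.2 hkN) (Set.mem_Iio.2 (by omega : 0 < _)) hc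
      omega)
  exact hno g hg u w h

/-- The weight of a path that is not closed and contains no broken wheel of the given colour. -/
theorem sum_le_of_isPath {σ : Equiv.Perm A} (hσ : ∀ e, X.src (σ e) = X.tgt e)
    (hR : HasCycleSum σ R) (hpos : ∀ e, 0 < R e) (hlt : ∀ e, R e < 1) {p : List A}
    {a b : V} (hp : X.IsPath a p b) (hnd : (p.map X.src).Nodup) (hb : ∀ y ∈ p, X.src y ≠ b)
    (hno : ∀ e ∈ p, ∀ g, σ.SameCycle e g → ∀ u w, p ≠ u ++ (boundary σ g).tail ++ w) :
    ∑ x ∈ p.toFinset, R x ≤ ∑ x ∈ exits σ p.toFinset, (1 - R x) +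
      ∑ x ∈ entrances σ p.toFinset, (1 - R x) := by
  refine hR.sum_le_of_missing hpos hlt fun e he => ?_
  simpa using exists_missing hσ hp hnd (hR.two_lt_period hlt) (hno e (by simpa using he))
    fun y hy _ => hb y hy

/-- The weight of a closed path that contains no broken wheel of the given colour. The cycle through
the first arrow is exceptional, since the path may run through a broken wheel of it across the base
point. -/
theorem sum_lt_of_isPath_closed {σ : Equiv.Perm A} (hσ : ∀ e, X.src (σ e) = X.tgt e)
    (hR : HasCycleSum σ R) (hpos : ∀ e, 0 < R e) (hlt : ∀ e, R e < 1) {p : List A}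
    {a : V} (hp : X.IsPath a p a) (hne : p ≠ []) (hnd : (p.map X.src).Nodup)
    (hno : ∀ e ∈ p, ∀ g, σ.SameCycle e g → ∀ u w, p ≠ u ++ (boundary σ g).tail ++ w) :
    ∑ x ∈ p.toFinset, R x < 2 + ∑ x ∈ exits σ p.toFinset, (1 - R x) +
      ∑ x ∈ entrances σ p.toFinset, (1 - R x) := by
  obtain ⟨e₀, q, rfl⟩ := List.exists_cons_of_ne_nil hne
  set p := e₀ :: q with hpq
  have he₀ : e₀ ∈ p := by simp [hpq]
  have hstart : ∀ y ∈ p, X.src y = a → y = e₀ := fun y hy h =>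
    List.inj_on_of_nodup_map hnd hy he₀ (h.trans hp.1.symm)
  have hN := hR.two_lt_period hlt
  obtain ⟨g₀, hg₀, hg₀p⟩ : ∃ g₀, σ.SameCycle e₀ g₀ ∧ g₀ ∉ p := by
    by_contra! hcon
    have hcyc : σ.SameCycle e₀ (σ.symm e₀) := ⟨-1, by simp⟩
    obtain ⟨u, w, h⟩ := exists_broken_wheel hσ hp hnd (hN (σ.symm e₀))
      (fun y hy _ => hcon y (hcyc.trans hy)) (by
        intro k hk hkN hc
        have h1 := hstart _ (hcon _ (hcyc.trans (sameCycle_pow σ k _))) hc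
        have h2 := pow_injOn_period σ (σ.symm e₀) (Set.mem_Iio.2 hkN)
          (Set.mem_Iio.2 (by omega : 1 < _)) (h1.trans (by simp))
        omega)
    exact hno e₀ he₀ _ hcyc u w h
  refine hR.sum_lt_of_missing hpos hlt hg₀ (by simpa using hg₀p) fun e he hee => ?_
  have he' : e ∈ p := by simpa using he
  have := exists_missing hσ hp hnd hN (hno e he') fun y hy hey hya => by
    rw [hstart y hy hya] at hey
    exact hee hey.symm
  simpa using this

end Paths

end SurfaceQuiver

namespace SurfaceQuiver

/-! ### Reduction to simple pairs of paths -/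

section Simple

open Function Classical

variable {V : Type u} {A : Type v} {X : SurfaceQuiver V A}

theorem exists_boundary_tail_eq_cons {σ : Equiv.Perm A} {e : A} (hN : 1 < minimalPeriod σ e) :
    ∃ l, (boundary σ e).tail = σ e :: l := by
  obtain ⟨n, hn⟩ : ∃ n, minimalPeriod σ e = n + 1 + 1 := ⟨_, (Nat.sub_add_cancel hN).symm⟩
  rw [boundary, hn, List.range_succ_eq_map (n := n + 1), List.map_cons, List.tail_cons,
    List.range_succ_eq_map]
  exact ⟨_, rfl⟩

/-- For faces with at least two sides, the position of a broken wheel in a path determines its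
starting point. -/
theorem containsBrokenWheel_iff (hb : ∀ e, 1 < minimalPeriod X.blue e)
    (hr : ∀ e, 1 < minimalPeriod X.red e) {p : List A} {a b : V} (hp : X.IsPath a p b) {e : A} :
    X.ContainsBrokenWheel a p e ↔ (∃ u w, p = u ++ (boundary X.blue e).tail ++ w) ∨
      ∃ u w, p = u ++ (boundary X.red e).tail ++ w := by
  constructor
  · rintro ⟨u, l, w, rfl | rfl, h, -⟩
    · exact Or.inl ⟨u, w, h⟩
    · exact Or.inr ⟨u, w, h⟩
  · rintro (⟨u, w, rfl⟩ | ⟨u, w, rfl⟩)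
    · refine ⟨u, _, w, Or.inl rfl, rfl, ?_⟩
      obtain ⟨l, hl⟩ := exists_boundary_tail_eq_cons (hb e)
      rw [hl, List.append_assoc, List.cons_append] at hp
      rw [← X.src_blue]
      exact hp.split.1
    · refine ⟨u, _, w, Or.inr rfl, rfl, ?_⟩
      obtain ⟨l, hl⟩ := exists_boundary_tail_eq_cons (hr e)
      rw [hl, List.append_assoc, List.cons_append] at hp
      rw [← X.src_red]
      exact hp.split.1

theorem faceAdj_symm {S : Set A} {F G : X.Face} (h : X.FaceAdj S F G) : X.FaceAdj S G F := by
  obtain ⟨e, he, h | h⟩ := h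
  · exact ⟨e, he, Or.inr ⟨h.2, h.1⟩⟩
  · exact ⟨e, he, Or.inl ⟨h.2, h.1⟩⟩

theorem Encloses.mono {S S' : Set A} (hS : S ⊆ S') {F : X.Face} (h : X.Encloses S F) :
    X.Encloses S' F := by
  refine Set.Finite.subset h fun G hG => ?_
  have hle : X.FaceAdj S' ≤ X.FaceAdj S := fun F G ⟨e, he, h⟩ => ⟨e, fun hc => he (hS hc), h⟩
  exact Relation.ReflTransGen.mono hle _ _ hG

theorem InRegion.mono {p p' q q' : List A} (h : ∀ x, x ∈ q ∨ x ∈ q' → x ∈ p ∨ x ∈ p') {e : A}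
    (he : X.InRegion q q' e) : X.InRegion p p' e :=
  he.imp (fun h' => Encloses.mono h h') (fun h' => Encloses.mono h h')

/-- Two paths from `a` to `b` which together form a simple closed curve: they meet in their end
points only and have no repeated vertices. One of them may be trivial, in which case the other one
is a simple closed path. -/
structure SimplePair (X : SurfaceQuiver V A) (a b : V) (p p' : List A) : Prop where
  path : X.IsPath a p b
  path' : X.IsPath a p' b
  ne : p ≠ p'
  src_nodup : (p.map X.src).Nodup
  src_nodup' : (p'.map X.src).Nodup
  tgt_nodup : (p.map X.tgt).Nodup
  tgt_nodup' : (p'.map X.tgt).Nodup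
  src_meet : ∀ e ∈ p, ∀ f ∈ p', X.src e = X.src f → X.src e = a
  tgt_meet : ∀ e ∈ p, ∀ f ∈ p', X.tgt e = X.tgt f → X.tgt e = b
  tgt_ne_src : ∀ e ∈ p, ∀ f ∈ p', X.tgt e ≠ X.src f
  src_ne_tgt : ∀ e ∈ p, ∀ f ∈ p', X.src e ≠ X.tgt f
  disj : ∀ e ∈ p, e ∉ p'
  src_ne_end : p' ≠ [] → ∀ e ∈ p, X.src e ≠ b
  src_ne_end' : p ≠ [] → ∀ e ∈ p', X.src e ≠ b
  tgt_ne_start : p' ≠ [] → ∀ e ∈ p, X.tgt e ≠ a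
  tgt_ne_start' : p ≠ [] → ∀ e ∈ p', X.tgt e ≠ a

theorem SimplePair.symm {a b : V} {p p' : List A} (h : X.SimplePair a b p p') :
    X.SimplePair a b p' p where
  path := h.path'
  path' := h.path
  ne := h.ne.symm
  src_nodup := h.src_nodup'
  src_nodup' := h.src_nodup
  tgt_nodup := h.tgt_nodup'
  tgt_nodup' := h.tgt_nodup
  src_meet e he f hf hef := hef.trans (h.src_meet f hf e he hef.symm)
  tgt_meet e he f hf hef := hef.trans (h.tgt_meet f hf e he hef.symm)
  tgt_ne_src e he f hf hef := h.src_ne_tgt f hf e he hef.symm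
  src_ne_tgt e he f hf hef := h.tgt_ne_src f hf e he hef.symm
  disj e he he' := h.disj e he' he
  src_ne_end := h.src_ne_end'
  src_ne_end' := h.src_ne_end
  tgt_ne_start := h.tgt_ne_start'
  tgt_ne_start' := h.tgt_ne_start

theorem pairwise_of_forall_split {α : Type*} {r : α → α → Prop} {l : List α}
    (h : ∀ u e v f w, l = u ++ e :: (v ++ f :: w) → r e f) : l.Pairwise r := by
  induction l with
  | nil => exact List.Pairwise.nil
  | cons x l ih =>
    refine List.Pairwise.cons (fun y hy => ?_)
      (ih fun u e v f w hl => h (x :: u) e v f w (by simp [hl]))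
    obtain ⟨v, w, rfl⟩ := List.append_of_mem hy
    exact h [] x v y w rfl

/-- A path all of whose closed subpaths are trivial has no repeated vertices. -/
theorem nodup_of_minimal {p : List A} {a b : V} (hp : X.IsPath a p b)
    (hmin : ∀ (c : V) (q : List A), X.IsPath c q c → q <:+: p → q.length < p.length → q = []) :
    (p.map X.src).Nodup ∧ (p.map X.tgt).Nodup := by
  constructor
  · refine List.pairwise_map.2 (pairwise_of_forall_split ?_)
    rintro u e v f w rfl hef
    have h1 := hp.split.2.split.1
    have := hmin (X.src e) (e :: v) ⟨rfl, hef ▸ h1⟩ ⟨u, f :: w, by simp⟩ (by simp; omega)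
    simp at this
  · refine List.pairwise_map.2 (pairwise_of_forall_split ?_)
    rintro u e v f w rfl hef
    have h1 := hp.split.2.split.1.concat
    have := hmin (X.tgt e) (v ++ [f]) (by rwa [← hef] at h1) ⟨u ++ [e], w, by simp⟩
      (by simp; omega)
    simp at this

/-- Two distinct paths with the same end points, such that no two shorter subpaths of them have this
property. -/
structure IsMinimalPair (X : SurfaceQuiver V A) (a b : V) (p p' : List A) : Prop where
  path : X.IsPath a p b
  path' : X.IsPath a p' b
  ne : p ≠ p'
  eq_of_shorter : ∀ (c d : V) (q q' : List A), X.IsPath c q d → X.IsPath c q' d →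
    (q <:+: p ∨ q <:+: p') → (q' <:+: p ∨ q' <:+: p') →
    q.length + q'.length < p.length + p'.length → q = q'

namespace IsMinimalPair

variable {a b : V} {p p' : List A}

theorem symm (h : X.IsMinimalPair a b p p') : X.IsMinimalPair a b p' p :=
  ⟨h.path', h.path, h.ne.symm, fun c d q q' hq hq' h1 h2 hl =>
    h.eq_of_shorter c d q q' hq hq' h1.symm h2.symm (by omega)⟩

theorem closed_eq_nil (h : X.IsMinimalPair a b p p') {c : V} {q : List A} (hq : X.IsPath c q c)
    (hqp : q <:+: p) (hl : q.length < p.length + p'.length) : q = [] :=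
  h.eq_of_shorter c c q [] hq rfl (Or.inl hqp) (Or.inl List.nil_infix) (by simpa using hl)

theorem nodup (h : X.IsMinimalPair a b p p') : (p.map X.src).Nodup ∧ (p.map X.tgt).Nodup :=
  nodup_of_minimal h.path fun _ _ hq hqp hl => h.closed_eq_nil hq hqp (by omega)

/-- Cutting both paths at a common vertex yields two pairs of shorter paths, which therefore
coincide. -/
theorem eq_of_cut (h : X.IsMinimalPair a b p p') {c : V} {u w u' w' : List A}
    (hp : p = u ++ w) (hp' : p' = u' ++ w') (hu : X.IsPath a u c) (hw : X.IsPath c w b)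
    (hu' : X.IsPath a u' c) (hw' : X.IsPath c w' b) :
    (0 < w.length + w'.length → u = u') ∧ (0 < u.length + u'.length → w = w') := by
  constructor
  · intro hl
    refine h.eq_of_shorter a c u u' hu hu' (Or.inl ⟨[], w, by simp [hp]⟩)
      (Or.inr ⟨[], w', by simp [hp']⟩) ?_
    simp only [hp, hp', List.length_append]
    omega
  · intro hl
    refine h.eq_of_shorter c b w w' hw hw' (Or.inl ⟨u, [], by simp [hp]⟩)
      (Or.inr ⟨u', [], by simp [hp']⟩) ?_
    simp only [hp, hp', List.length_append]
    omega

/-- A common vertex of the two paths is the first vertex or the last vertex of both. -/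
theorem nil_of_cut (h : X.IsMinimalPair a b p p') {c : V} {u w u' w' : List A}
    (hp : p = u ++ w) (hp' : p' = u' ++ w') (hu : X.IsPath a u c) (hw : X.IsPath c w b)
    (hu' : X.IsPath a u' c) (hw' : X.IsPath c w' b) :
    (u = [] ∧ u' = []) ∨ (w = [] ∧ w' = []) := by
  obtain ⟨h1, h2⟩ := h.eq_of_cut hp hp' hu hw hu' hw'
  by_contra hcon
  rw [not_or, ← List.append_eq_nil_iff, ← List.append_eq_nil_iff, ← ne_eq, ← ne_eq,
    ← List.length_pos_iff, ← List.length_pos_iff, List.length_append, List.length_append] at hcon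
  exact h.ne (by rw [hp, hp', h1 hcon.2, h2 hcon.1])

theorem cut_src (h : X.IsMinimalPair a b p p') {e : A} {u w : List A} (hp : p = u ++ e :: w) :
    X.IsPath a u (X.src e) ∧ X.IsPath (X.src e) (e :: w) b := by
  have h1 := (hp ▸ h.path).split
  exact ⟨h1.1, rfl, h1.2⟩

theorem cut_tgt (h : X.IsMinimalPair a b p p') {e : A} {u w : List A} (hp : p = u ++ e :: w) :
    X.IsPath a (u ++ [e]) (X.tgt e) ∧ X.IsPath (X.tgt e) w b := by
  have h1 := (hp ▸ h.path).split
  exact ⟨h1.1.concat, h1.2⟩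

theorem src_meet (h : X.IsMinimalPair a b p p') {e f : A} (he : e ∈ p) (hf : f ∈ p')
    (hef : X.src e = X.src f) : X.src e = a := by
  obtain ⟨u, w, hpe⟩ := List.append_of_mem he
  obtain ⟨u', w', hpf⟩ := List.append_of_mem hf
  have h1 := h.cut_src hpe
  have h2 := h.symm.cut_src hpf
  rw [← hef] at h2
  rcases h.nil_of_cut hpe hpf h1.1 h1.2 h2.1 h2.2 with h3 | h3
  · rw [h3.1] at h1
    exact h1.1.symm
  · simp at h3

theorem tgt_meet (h : X.IsMinimalPair a b p p') {e f : A} (he : e ∈ p) (hf : f ∈ p')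
    (hef : X.tgt e = X.tgt f) : X.tgt e = b := by
  obtain ⟨u, w, hpe⟩ := List.append_of_mem he
  obtain ⟨u', w', hpf⟩ := List.append_of_mem hf
  have h1 := h.cut_tgt hpe
  have h2 := h.symm.cut_tgt hpf
  rw [← hef] at h2
  rcases h.nil_of_cut (by simp [hpe]) (by simp [hpf]) h1.1 h1.2 h2.1 h2.2 with h3 | h3
  · simp at h3
  · rw [h3.1] at h1
    exact h1.2

theorem tgt_ne_src (h : X.IsMinimalPair a b p p') {e f : A} (he : e ∈ p) (hf : f ∈ p') :
    X.tgt e ≠ X.src f := by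
  intro hef
  obtain ⟨u, w, hpe⟩ := List.append_of_mem he
  obtain ⟨u', w', hpf⟩ := List.append_of_mem hf
  have h1 := h.cut_tgt hpe
  have h2 := h.symm.cut_src hpf
  rw [← hef] at h2
  rcases h.nil_of_cut (by simp [hpe]) hpf h1.1 h1.2 h2.1 h2.2 with h3 | h3 <;> simp at h3

theorem disjoint (h : X.IsMinimalPair a b p p') {e : A} (he : e ∈ p) : e ∉ p' := by
  intro hf
  obtain ⟨u, w, hpe⟩ := List.append_of_mem he
  obtain ⟨u', w', hpf⟩ := List.append_of_mem hf
  have h1 := h.cut_src hpe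
  have h2 := h.symm.cut_src hpf
  have h3 := h.cut_tgt hpe
  have h4 := h.symm.cut_tgt hpf
  have h5 := (h.eq_of_cut hpe hpf h1.1 h1.2 h2.1 h2.2).1 (by simp)
  have h6 := (h.eq_of_cut (by simp [hpe]) (by simp [hpf]) h3.1 h3.2 h4.1 h4.2).2 (by simp)
  exact h.ne (by rw [hpe, hpf, h5, h6])

theorem src_ne_end (h : X.IsMinimalPair a b p p') (h0 : p' ≠ []) {e : A} (he : e ∈ p) :
    X.src e ≠ b := by
  intro heb
  obtain ⟨u, w, hpe⟩ := List.append_of_mem he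
  have := h.closed_eq_nil (heb ▸ (h.cut_src hpe).2) ⟨u, [], by simp [hpe]⟩ (by
    have := List.length_pos_iff.2 h0
    simp only [hpe, List.length_append]
    omega)
  simp at this

theorem tgt_ne_start (h : X.IsMinimalPair a b p p') (h0 : p' ≠ []) {e : A} (he : e ∈ p) :
    X.tgt e ≠ a := by
  intro heb
  obtain ⟨u, w, hpe⟩ := List.append_of_mem he
  have := h.closed_eq_nil (by simpa only [heb] using (h.cut_tgt hpe).1) ⟨[], w, by simp [hpe]⟩ (by
    have := List.length_pos_iff.2 h0
    simp only [hpe, List.length_append, List.length_cons, List.length_nil]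
    omega)
  simp at this

theorem simplePair (h : X.IsMinimalPair a b p p') : X.SimplePair a b p p' where
  path := h.path
  path' := h.path'
  ne := h.ne
  src_nodup := h.nodup.1
  src_nodup' := h.symm.nodup.1
  tgt_nodup := h.nodup.2
  tgt_nodup' := h.symm.nodup.2
  src_meet _ he _ hf := h.src_meet he hf
  tgt_meet _ he _ hf := h.tgt_meet he hf
  tgt_ne_src _ he _ hf := h.tgt_ne_src he hf
  src_ne_tgt _ he _ hf := (h.symm.tgt_ne_src hf he).symm
  disj _ he := h.disjoint he
  src_ne_end h0 _ he := h.src_ne_end h0 he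
  src_ne_end' h0 _ he := h.symm.src_ne_end h0 he
  tgt_ne_start h0 _ he := h.tgt_ne_start h0 he
  tgt_ne_start' h0 _ he := h.symm.tgt_ne_start h0 he

end IsMinimalPair

end Simple

end SurfaceQuiver

namespace SurfaceQuiver

/-! ### Planar quivers and the two sides of a simple closed curve -/

section Jordan

open Function Classical

variable {V : Type u} {A : Type v} {X : SurfaceQuiver V A} {R : A → ℝ}

/-- The properties of the universal cover of a torus quiver, with the pulled back `R`-charge, that
enter the argument. Planarity is expressed by `exact`: the first homology vanishes, i.e. a
finite `1`-chain without boundary is the boundary of a finite `2`-chain `n`. Blue faces are bounded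
by their arrows and red faces by the reversed arrows, so the boundary of `n` has the coefficient
`n (blue face) - n (red face)` at each arrow. -/
structure IsPlanar (X : SurfaceQuiver V A) (R : A → ℝ) : Prop where
  link : ∀ e e', X.src e = X.src e' → ∃ k : ℕ, ((X.red * X.blue⁻¹) ^ k) e = e'
  connected : ∀ i j, Relation.EqvGen (fun a b => ∃ e, X.src e = a ∧ X.tgt e = b) i j
  exact : ∀ z : A →₀ ℝ, z.mapDomain X.tgt = z.mapDomain X.src →
    ∃ n : X.Face →₀ ℝ, ∀ e, z e = n (X.blueFaceOf e) - n (X.redFaceOf e)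
  pos : ∀ e, 0 < R e
  lt_one : ∀ e, R e < 1
  blue_sum : HasCycleSum X.blue R
  red_sum : HasCycleSum X.red R
  vertex : ∀ v, ∃ O N : Finset A, (∀ e, e ∈ O ↔ X.src e = v) ∧ (∀ e, e ∈ N ↔ X.tgt e = v) ∧
    ∑ e ∈ O, (1 - R e) + ∑ e ∈ N, (1 - R e) = 2

theorem blueFaceOf_eq_iff {e f : A} :
    X.blueFaceOf e = X.blueFaceOf f ↔ X.blue.SameCycle e f :=
  ⟨fun h => cyc_eq_iff.1 (Sum.inl.inj h), fun h => congrArg Sum.inl (cyc_eq_iff.2 h)⟩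

theorem redFaceOf_eq_iff {e f : A} :
    X.redFaceOf e = X.redFaceOf f ↔ X.red.SameCycle e f :=
  ⟨fun h => cyc_eq_iff.1 (Sum.inr.inj h), fun h => congrArg Sum.inr (cyc_eq_iff.2 h)⟩

theorem exists_eq_face (F : X.Face) : (∃ e, X.blueFaceOf e = F) ∨ ∃ e, X.redFaceOf e = F := by
  rcases F with F | F
  · induction F using Quotient.ind with
    | _ e => exact Or.inl ⟨e, rfl⟩
  · induction F using Quotient.ind with
    | _ e => exact Or.inr ⟨e, rfl⟩

/-- Two faces can be joined without crossing `S`. -/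
def Reach (X : SurfaceQuiver V A) (S : Set A) : X.Face → X.Face → Prop :=
  Relation.ReflTransGen (X.FaceAdj S)

theorem Reach.refl (S : Set A) (F : X.Face) : X.Reach S F F := Relation.ReflTransGen.refl

theorem Reach.trans {S : Set A} {F G H : X.Face} (h : X.Reach S F G) (h' : X.Reach S G H) :
    X.Reach S F H := Relation.ReflTransGen.trans h h'

theorem Reach.symm {S : Set A} {F G : X.Face} (h : X.Reach S F G) : X.Reach S G F := by
  induction h with
  | refl => exact Reach.refl S F
  | tail _ h ih => exact Reach.trans (Relation.ReflTransGen.single (faceAdj_symm h)) ih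

theorem reach_blue_red {S : Set A} {e : A} (he : e ∉ S) :
    X.Reach S (X.blueFaceOf e) (X.redFaceOf e) :=
  Relation.ReflTransGen.single ⟨e, he, Or.inl ⟨rfl, rfl⟩⟩

theorem Reach.mem_iff {S : Set A} {D : Set X.Face}
    (hD : ∀ e, e ∉ S → (X.blueFaceOf e ∈ D ↔ X.redFaceOf e ∈ D)) {F G : X.Face}
    (h : X.Reach S F G) : F ∈ D ↔ G ∈ D := by
  induction h with
  | refl => exact Iff.rfl
  | tail _ h ih =>
    obtain ⟨e, he, ⟨rfl, rfl⟩ | ⟨rfl, rfl⟩⟩ := h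
    · exact ih.trans (hD e he)
    · exact ih.trans (hD e he).symm

/-- Darts are arrows with one of their ends: `(e, true)` is attached to the source of `e` and
`(e, false)` to its target. The next dart, in clockwise order, at the same vertex. -/
def rot (X : SurfaceQuiver V A) (d : A × Bool) : A × Bool :=
  if d.2 then (X.blue.symm d.1, false) else (X.red d.1, true)

/-- The face following a dart in clockwise order. -/
def rightFace (X : SurfaceQuiver V A) (d : A × Bool) : X.Face :=
  if d.2 then X.blueFaceOf d.1 else X.redFaceOf d.1

/-- The face preceding a dart in clockwise order. -/
def leftFace (X : SurfaceQuiver V A) (d : A × Bool) : X.Face :=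
  if d.2 then X.redFaceOf d.1 else X.blueFaceOf d.1

theorem leftFace_rot (d : A × Bool) : X.leftFace (X.rot d) = X.rightFace d := by
  obtain ⟨e, b⟩ := d
  cases b
  · exact redFaceOf_eq_iff.2 (Equiv.Perm.SameCycle.symm ⟨1, rfl⟩)
  · exact blueFaceOf_eq_iff.2 (Equiv.Perm.SameCycle.symm ⟨-1, by rw [zpow_neg_one]; rfl⟩)

theorem reach_leftFace_rightFace {S : Set A} {d : A × Bool} (hd : d.1 ∉ S) :
    X.Reach S (X.leftFace d) (X.rightFace d) := by
  obtain ⟨e, b⟩ := d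
  cases b
  · exact reach_blue_red hd
  · exact (reach_blue_red hd).symm

theorem stepStart_iterate_rot (j : ℕ) (c : A × Bool) :
    X.stepStart (X.rot^[j] c) = X.stepStart c := by
  induction j with
  | zero => rfl
  | succ j ih =>
    rw [iterate_succ_apply', ← ih]
    obtain ⟨e, b⟩ := X.rot^[j] c
    cases b
    · exact X.src_red e
    · change X.tgt (X.blue.symm e) = X.src e
      rw [← X.src_blue, Equiv.apply_symm_apply]

/-- Turning around a vertex as long as no arrow of `S` is met. -/
theorem reach_iterate_rot {S : Set A} {d : A × Bool} {k : ℕ}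
    (h : ∀ j, 0 < j → j ≤ k → (X.rot^[j] d).1 ∉ S) :
    X.Reach S (X.rightFace d) (X.leftFace (X.rot^[k + 1] d)) := by
  induction k with
  | zero => exact (leftFace_rot d).symm ▸ Reach.refl S _
  | succ k ih =>
    refine (ih fun j h0 hj => h j h0 (by omega)).trans ?_
    rw [iterate_succ_apply' X.rot (k + 1), leftFace_rot]
    exact reach_leftFace_rightFace (h (k + 1) (by omega) le_rfl)

namespace IsPlanar

theorem exists_iterate_rot (h : X.IsPlanar R) {d d' : A × Bool}
    (hd : X.stepStart d = X.stepStart d') : ∃ k, X.rot^[k] d = d' := by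
  have hpow : ∀ (k : ℕ) (e : A), ∃ m, X.rot^[m] (e, true) = (((X.red * X.blue⁻¹) ^ k) e, true) := by
    intro k e
    induction k with
    | zero => exact ⟨0, rfl⟩
    | succ k ih =>
      obtain ⟨m, hm⟩ := ih
      refine ⟨m + 1 + 1, ?_⟩
      rw [iterate_succ_apply', iterate_succ_apply', hm, pow_succ', Equiv.Perm.mul_apply]
      rfl
  have hto : ∀ d : A × Bool, ∃ (m : ℕ) (e : A),
      X.rot^[m] d = (e, true) ∧ X.src e = X.stepStart d := by
    rintro ⟨e, b⟩
    cases b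
    · exact ⟨1, X.red e, rfl, X.src_red e⟩
    · exact ⟨0, e, rfl, rfl⟩
  have hfrom : ∀ d : A × Bool, ∃ (m : ℕ) (e : A),
      X.rot^[m] (e, true) = d ∧ X.src e = X.stepStart d := by
    rintro ⟨e, b⟩
    cases b
    · refine ⟨1, X.blue e, ?_, X.src_blue e⟩
      simp [rot]
    · exact ⟨0, e, rfl, rfl⟩
  obtain ⟨m, e, hm, he⟩ := hto d
  obtain ⟨m', e', hm', he'⟩ := hfrom d'
  obtain ⟨k, hk⟩ := h.link e e' (by rw [he, he', hd])
  obtain ⟨l, hl⟩ := hpow k e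
  refine ⟨m' + (l + m), ?_⟩
  rw [iterate_add_apply, iterate_add_apply, hm, hl, hk, hm']

/-- If at most the two darts `d` and `d'` at a vertex belong to `S`, the face to the right of `d`
and the face to the left of `d'` lie in the same sector at this vertex. -/
theorem reach_of_two_darts (h : X.IsPlanar R) {S : Set A} {d d' : A × Bool}
    (hd : X.stepStart d = X.stepStart d') (hne : d ≠ d')
    (hS : ∀ c, X.stepStart c = X.stepStart d → c.1 ∈ S → c = d ∨ c = d') :
    X.Reach S (X.rightFace d) (X.leftFace d') := by
  have hex := h.exists_iterate_rot hd
  have hk := Nat.find_spec hex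
  have hmin := fun m => Nat.find_min hex (m := m)
  set k := Nat.find hex
  obtain ⟨m, hm⟩ : ∃ m, k = m + 1 := by
    refine Nat.exists_eq_succ_of_ne_zero fun h0 => hne ?_
    rw [h0] at hk
    exact hk
  rw [← hk, hm]
  refine reach_iterate_rot fun j h0 hj hc => ?_
  rcases hS _ (stepStart_iterate_rot j d) hc with h1 | h1
  · refine hmin (k - j) (by omega) ?_
    rw [← hk, ← Nat.sub_add_cancel (by omega : j ≤ k), iterate_add_apply, h1]
    simp
  · exact hmin j (by omega) h1

/-- All faces at a vertex which is not on `S` lie in the same component. -/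
theorem reach_of_no_dart (h : X.IsPlanar R) {S : Set A} {d d' : A × Bool}
    (hd : X.stepStart d = X.stepStart d')
    (hS : ∀ c, X.stepStart c = X.stepStart d → c.1 ∉ S) :
    X.Reach S (X.rightFace d) (X.rightFace d') := by
  by_cases hne : d = d'
  · rw [hne]
    exact Reach.refl S _
  · exact (h.reach_of_two_darts hd hne fun c hc hcS => absurd hcS (hS c hc)).trans
      (reach_leftFace_rightFace (hS d' hd.symm))

/-- From every face, a face incident to `S` can be reached without crossing `S`. -/
theorem exists_reach (h : X.IsPlanar R) {S : Set A} {e₀ : A} (he₀ : e₀ ∈ S) (F : X.Face) :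
    ∃ e ∈ S, X.Reach S F (X.blueFaceOf e) ∨ X.Reach S F (X.redFaceOf e) := by
  set N : X.Face → Prop := fun F =>
    ∃ e ∈ S, X.Reach S F (X.blueFaceOf e) ∨ X.Reach S F (X.redFaceOf e) with hN
  have hNtrans : ∀ {F G}, X.Reach S F G → N G → N F := by
    rintro F G hFG ⟨e, he, h1 | h1⟩
    · exact ⟨e, he, Or.inl (hFG.trans h1)⟩
    · exact ⟨e, he, Or.inr (hFG.trans h1)⟩
  -- A vertex is good if all faces around it reach `S`; this holds on `S`, and spreads along arrows.
  set P : V → Prop := fun v => ∀ d, X.stepStart d = v → N (X.rightFace d) with hP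
  have hPS : ∀ v, (∃ d, X.stepStart d = v ∧ d.1 ∈ S) → P v := by
    rintro v ⟨d', hd', hd'S⟩ d hd
    have hex : ∃ k, (X.rot^[k] d).1 ∈ S := by
      obtain ⟨k, hk⟩ := h.exists_iterate_rot (hd.trans hd'.symm)
      exact ⟨k, hk ▸ hd'S⟩
    have hk := Nat.find_spec hex
    have hmin := fun m => Nat.find_min hex (m := m)
    rcases hkk : Nat.find hex with _ | k
    · rw [hkk] at hk
      refine ⟨_, hk, ?_⟩
      obtain ⟨e, b⟩ := d
      cases b
      · exact Or.inr (Reach.refl S _)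
      · exact Or.inl (Reach.refl S _)
    · rw [hkk] at hk hmin
      refine hNtrans (reach_iterate_rot (k := k) fun j _ hj => hmin j (by omega)) ⟨_, hk, ?_⟩
      obtain ⟨e, b⟩ := X.rot^[k + 1] d
      cases b
      · exact Or.inl (Reach.refl S _)
      · exact Or.inr (Reach.refl S _)
  have hstep : ∀ d : A × Bool, N (X.leftFace d) → P (X.stepStart d) := by
    intro d hd
    by_cases hv : ∃ c, X.stepStart c = X.stepStart d ∧ c.1 ∈ S
    · exact hPS _ hv
    · push Not at hv
      intro c hc
      exact hNtrans (h.reach_of_no_dart hc fun c' hc' => hv c' (hc'.trans hc))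
        (hNtrans (reach_leftFace_rightFace (hv d rfl)).symm hd)
  have hiff : ∀ i j, Relation.EqvGen (fun a b => ∃ e, X.src e = a ∧ X.tgt e = b) i j →
      (P i ↔ P j) := by
    intro i j hij
    induction hij with
    | rel i j hij =>
      obtain ⟨e, rfl, rfl⟩ := hij
      exact ⟨fun hi => hstep (e, false) (hi (e, true) rfl),
        fun hj => hstep (e, true) (hj (e, false) rfl)⟩
    | refl i => exact Iff.rfl
    | symm i j _ ih => exact ih.symm
    | trans i j k _ _ ih ih' => exact ih.trans ih'
  have hall : ∀ v, P v := fun v =>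
    (hiff _ _ (h.connected (X.src e₀) v)).1 (hPS _ ⟨(e₀, true), rfl, he₀⟩)
  rcases exists_eq_face F with ⟨e, rfl⟩ | ⟨e, rfl⟩
  · exact hall _ (e, true) rfl
  · exact hall _ (e, false) rfl

end IsPlanar

/-- The set of arrows on one of two paths. -/
abbrev arrowSet (p p' : List A) : Set A := {x | x ∈ p ∨ x ∈ p'}

variable {a b : V} {p p' : List A}

/-- The faces on either side of a path belonging to a simple pair are connected to each other. -/
theorem SimplePair.reach_along (hX : X.IsPlanar R) (h : X.SimplePair a b p p') {y : A}
    {q : List A} (hp : p = y :: q) {e : A} (he : e ∈ p) :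
    X.Reach (arrowSet p p') (X.redFaceOf e) (X.redFaceOf y) ∧
      X.Reach (arrowSet p p') (X.blueFaceOf e) (X.blueFaceOf y) := by
  have key : ∀ (q u : List A) (x : A), p = u ++ x :: q → ∀ e ∈ x :: q,
      X.Reach (arrowSet p p') (X.redFaceOf e) (X.redFaceOf x) ∧
      X.Reach (arrowSet p p') (X.blueFaceOf e) (X.blueFaceOf x) := by
    intro q
    induction q with
    | nil =>
      intro u x _ e he
      rw [List.mem_singleton.1 he]
      exact ⟨Reach.refl _ _, Reach.refl _ _⟩
    | cons y q ih =>
      intro u x hpu e he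
      rcases List.mem_cons.1 he with rfl | he
      · exact ⟨Reach.refl _ _, Reach.refl _ _⟩
      have hx : x ∈ p := by simp [hpu]
      have hy : y ∈ p := by simp [hpu]
      have hxy : X.tgt x = X.src y := ((hpu ▸ h.path).split.2.1).symm
      have hS : ∀ c : A × Bool, X.stepStart c = X.src y → c.1 ∈ arrowSet p p' →
          c = (x, false) ∨ c = (y, true) := by
        rintro ⟨f, b'⟩ hc hf
        cases b'
        · change X.tgt f = _ at hc
          rcases hf with hf | hf
          · exact Or.inl (Prod.ext
              (List.inj_on_of_nodup_map h.tgt_nodup hf hx (hc.trans hxy.symm)) rfl)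
          · exact absurd hc.symm (h.src_ne_tgt y hy f hf)
        · change X.src f = _ at hc
          rcases hf with hf | hf
          · exact Or.inr (Prod.ext (List.inj_on_of_nodup_map h.src_nodup hf hy hc) rfl)
          · exact absurd (hxy.trans (h.src_meet y hy f hf hc.symm))
              (h.tgt_ne_start (List.ne_nil_of_mem hf) x hx)
      have hih := ih (u ++ [x]) y (by simp [hpu]) e he
      have h1 : X.Reach (arrowSet p p') (X.redFaceOf x) (X.redFaceOf y) :=
        hX.reach_of_two_darts (d := (x, false)) (d' := (y, true)) hxy (by simp)
          fun c hc hcS => hS c (hc.trans hxy) hcS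
      have h2 : X.Reach (arrowSet p p') (X.blueFaceOf y) (X.blueFaceOf x) :=
        hX.reach_of_two_darts (d := (y, true)) (d' := (x, false)) hxy.symm (by simp)
          fun c hc hcS => (hS c hc hcS).symm
      exact ⟨hih.1.trans h1.symm, hih.2.trans h2⟩
  exact key q [] y hp e (hp ▸ he)

theorem arrowSet_comm (p p' : List A) : arrowSet p p' = arrowSet p' p :=
  Set.ext fun _ => or_comm

/-- The left side of the closed curve `p * p'⁻¹`, consisting of the red faces along `p` and the
blue faces along `p'`, is connected, and so is its right side. -/
theorem SimplePair.exists_sides (hX : X.IsPlanar R) (h : X.SimplePair a b p p') :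
    ∃ l r : X.Face,
      (∀ e ∈ p, X.Reach (arrowSet p p') (X.redFaceOf e) l ∧
        X.Reach (arrowSet p p') (X.blueFaceOf e) r) ∧
      (∀ e ∈ p', X.Reach (arrowSet p p') (X.blueFaceOf e) l ∧
        X.Reach (arrowSet p p') (X.redFaceOf e) r) := by
  rcases hp : p with _ | ⟨y, q⟩
  · rcases hp' : p' with _ | ⟨y', q'⟩
    · exact absurd (hp.trans hp'.symm) h.ne
    · refine ⟨X.blueFaceOf y', X.redFaceOf y', by simp, fun e he => ?_⟩
      rw [← hp, ← hp', arrowSet_comm]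
      exact (h.symm.reach_along hX hp' (hp' ▸ he)).symm
  · refine ⟨X.redFaceOf y, X.blueFaceOf y, fun e he => ?_, fun e he => ?_⟩
    · rw [← hp]
      exact h.reach_along hX hp (hp ▸ he)
    · rcases hp' : p' with _ | ⟨y', q'⟩
      · simp [hp'] at he
      rw [← hp, ← hp']
      have h1 := h.symm.reach_along hX hp' he
      rw [arrowSet_comm] at h1
      have hy : y ∈ p := by simp [hp]
      have hy' : y' ∈ p' := by simp [hp']
      have hya : X.src y = a := (hp ▸ h.path).1
      have hya' : X.src y' = a := (hp' ▸ h.path').1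
      have hne : (y, true) ≠ (y', true) := fun hc =>
        h.disj y hy (by rwa [show y = y' from (Prod.ext_iff.1 hc).1])
      have hS : ∀ c : A × Bool, X.stepStart c = a → c.1 ∈ arrowSet p p' →
          c = (y, true) ∨ c = (y', true) := by
        rintro ⟨f, b'⟩ hc hf
        cases b'
        · change X.tgt f = _ at hc
          rcases hf with hf | hf
          · exact absurd hc (h.tgt_ne_start (List.ne_nil_of_mem hy') f hf)
          · exact absurd hc (h.tgt_ne_start' (List.ne_nil_of_mem hy) f hf)
        · change X.src f = _ at hc
          rcases hf with hf | hf
          · exact Or.inl (Prod.ext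
              (List.inj_on_of_nodup_map h.src_nodup hf hy (hc.trans hya.symm)) rfl)
          · exact Or.inr (Prod.ext
              (List.inj_on_of_nodup_map h.src_nodup' hf hy' (hc.trans hya'.symm)) rfl)
      have h2 : X.Reach (arrowSet p p') (X.blueFaceOf y) (X.redFaceOf y') :=
        hX.reach_of_two_darts (d := (y, true)) (d' := (y', true)) (hya.trans hya'.symm) hne
          fun c hc hcS => hS c (hc.trans hya) hcS
      have h3 : X.Reach (arrowSet p p') (X.blueFaceOf y') (X.redFaceOf y) :=
        hX.reach_of_two_darts (d := (y', true)) (d' := (y, true)) (hya'.trans hya.symm) hne.symm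
          fun c hc hcS => (hS c (hc.trans hya') hcS).symm
      exact ⟨h1.2.trans h3, h1.1.trans h2.symm⟩

/-- The `1`-chain of a path. -/
noncomputable def pathChain (p : List A) : A →₀ ℝ := (p.map fun e => Finsupp.single e 1).sum

theorem pathChain_apply {p : List A} (hp : p.Nodup) (e : A) :
    pathChain p e = if e ∈ p then 1 else 0 := by
  induction p with
  | nil => simp [pathChain]
  | cons x p ih =>
    obtain ⟨hx, hp⟩ := List.nodup_cons.1 hp
    have ih := ih hp
    rw [pathChain] at ih
    rw [pathChain, List.map_cons, List.sum_cons, Finsupp.add_apply, ih, Finsupp.single_apply]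
    by_cases hxe : x = e
    · subst hxe
      simp [hx]
    · simp [hxe, Ne.symm hxe]

theorem IsPath.mapDomain_pathChain {p : List A} {i j : V} (h : X.IsPath i p j) :
    (pathChain p).mapDomain X.tgt + Finsupp.single i 1 =
      (pathChain p).mapDomain X.src + Finsupp.single j 1 := by
  induction p generalizing i with
  | nil => rw [show i = j from h]; simp [pathChain]
  | cons x p ih =>
    have h1 := ih h.2
    have hx : pathChain (x :: p) = Finsupp.single x 1 + pathChain p := by simp [pathChain]
    rw [hx, Finsupp.mapDomain_add, Finsupp.mapDomain_add, Finsupp.mapDomain_single,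
      Finsupp.mapDomain_single, h.1, add_assoc, add_assoc, ← h1]
    abel

/-- The Jordan curve theorem for a simple pair: one of the two sides of the curve is a finite set
of faces with connected complement. The second alternative is the first one for the pair with the
two paths exchanged. -/
theorem SimplePair.exists_region (hX : X.IsPlanar R) (h : X.SimplePair a b p p') :
    ∃ D : Finset X.Face,
      (∀ e, e ∉ arrowSet p p' → (X.blueFaceOf e ∈ D ↔ X.redFaceOf e ∈ D)) ∧
      (∀ F G, F ∉ D → G ∉ D → X.Reach (arrowSet p p') F G) ∧
      (((∀ e ∈ p, X.redFaceOf e ∈ D ∧ X.blueFaceOf e ∉ D) ∧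
          ∀ e ∈ p', X.blueFaceOf e ∈ D ∧ X.redFaceOf e ∉ D) ∨
        ((∀ e ∈ p', X.redFaceOf e ∈ D ∧ X.blueFaceOf e ∉ D) ∧
          ∀ e ∈ p, X.blueFaceOf e ∈ D ∧ X.redFaceOf e ∉ D)) := by
  obtain ⟨l, r, hp, hp'⟩ := h.exists_sides hX
  have hbd : (pathChain p - pathChain p').mapDomain X.tgt =
      (pathChain p - pathChain p').mapDomain X.src := by
    have h1 := h.path.mapDomain_pathChain
    have h2 := h.path'.mapDomain_pathChain
    have hsub : ∀ f : A → V, (pathChain p - pathChain p').mapDomain f =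
        (pathChain p).mapDomain f - (pathChain p').mapDomain f := fun f =>
      (Finsupp.lmapDomain ℝ ℝ f).map_sub _ _
    rw [hsub, hsub, ← add_sub_add_right_eq_sub _ _ (Finsupp.single a 1), h1, h2,
      add_sub_add_right_eq_sub]
  obtain ⟨n, hn⟩ := hX.exact _ hbd
  have hz : ∀ e, n (X.blueFaceOf e) - n (X.redFaceOf e) =
      (if e ∈ p then 1 else 0) - (if e ∈ p' then 1 else 0) := fun e => by
    rw [← hn, Finsupp.sub_apply, pathChain_apply h.src_nodup.of_map,
      pathChain_apply h.src_nodup'.of_map]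
  have hconst : ∀ {F G}, X.Reach (arrowSet p p') F G → n F = n G := fun {F G} hFG => by
    refine ((hFG.mem_iff (D := {H | n H = n G}) fun e he => ?_).2 rfl)
    have := hz e
    rw [if_neg fun hc => he (Or.inl hc), if_neg fun hc => he (Or.inr hc), sub_zero,
      sub_eq_zero] at this
    change n (X.blueFaceOf e) = n G ↔ n (X.redFaceOf e) = n G
    rw [this]
  have hlr : n r = n l + 1 := by
    by_cases h0 : p = []
    · obtain ⟨e, he⟩ := List.exists_mem_of_ne_nil p' fun hc => h.ne (h0.trans hc.symm)
      have := hz e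
      rw [if_neg fun hc => h.disj e hc he, if_pos he, hconst (hp' e he).1,
        hconst (hp' e he).2] at this
      linarith
    · obtain ⟨e, he⟩ := List.exists_mem_of_ne_nil p h0
      have := hz e
      rw [if_pos he, if_neg (h.disj e he), hconst (hp e he).1, hconst (hp e he).2] at this
      linarith
  have hsides : ∀ F, X.Reach (arrowSet p p') F l ∨ X.Reach (arrowSet p p') F r := by
    obtain ⟨e₀, he₀⟩ : ∃ e, e ∈ arrowSet p p' := by
      by_contra! hcon
      exact h.ne ((List.eq_nil_iff_forall_not_mem.2 fun e he => hcon e (Or.inl he)).trans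
        (List.eq_nil_iff_forall_not_mem.2 fun e he => hcon e (Or.inr he)).symm)
    intro F
    obtain ⟨e, he | he, h1 | h1⟩ := hX.exists_reach he₀ F
    · exact Or.inr (h1.trans (hp e he).2)
    · exact Or.inl (h1.trans (hp e he).1)
    · exact Or.inl (h1.trans (hp' e he).1)
    · exact Or.inr (h1.trans (hp' e he).2)
  have hregion : ∀ s t, (∀ F, X.Reach (arrowSet p p') F s ∨ X.Reach (arrowSet p p') F t) →
      n s ≠ 0 → ∃ D : Finset X.Face, (∀ F, F ∈ D ↔ n F = n s) ∧
        (∀ e, e ∉ arrowSet p p' → (X.blueFaceOf e ∈ D ↔ X.redFaceOf e ∈ D)) ∧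
        (∀ F G, F ∉ D → G ∉ D → X.Reach (arrowSet p p') F G) := by
    intro s t hst h0
    have hmem : ∀ F, F ∈ n.support.filter (fun F => n F = n s) ↔ n F = n s := fun F => by
      rw [Finset.mem_filter, Finsupp.mem_support_iff]
      exact ⟨fun h => h.2, fun h => ⟨h ▸ h0, h⟩⟩
    refine ⟨n.support.filter fun F => n F = n s, hmem, fun e he => ?_, fun F G hF hG => ?_⟩
    · rw [hmem, hmem, hconst (reach_blue_red he)]
    · rw [hmem] at hF hG
      exact ((hst F).resolve_left fun hc => hF (hconst hc)).trans
        ((hst G).resolve_left fun hc => hG (hconst hc)).symm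
  -- The winding numbers of the two sides differ by one, so one of them does not vanish.
  by_cases h0 : n l = 0
  · obtain ⟨D, hD, h1, h2⟩ := hregion r l (fun F => (hsides F).symm) (by rw [hlr, h0]; norm_num)
    refine ⟨D, h1, h2, Or.inr ⟨fun e he => ?_, fun e he => ?_⟩⟩
    · rw [hD, hD, hconst (hp' e he).1, hconst (hp' e he).2, hlr]
      simp
    · rw [hD, hD, hconst (hp e he).1, hconst (hp e he).2, hlr]
      simp
  · obtain ⟨D, hD, h1, h2⟩ := hregion l r hsides h0
    refine ⟨D, h1, h2, Or.inl ⟨fun e he => ?_, fun e he => ?_⟩⟩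
    · rw [hD, hD, hconst (hp e he).1, hconst (hp e he).2, hlr]
      simp
    · rw [hD, hD, hconst (hp' e he).1, hconst (hp' e he).2, hlr]
      simp

end Jordan

end SurfaceQuiver

namespace SurfaceQuiver

/-! ### The Euler characteristic and the Gauss-Bonnet inequality -/

section GaussBonnet

open Function Classical

variable {V : Type u} {A : Type v} {X : SurfaceQuiver V A} {R : A → ℝ}

/-- The closure of a finite set of faces with connected complement has Euler characteristic at
least `1`: its first homology vanishes, because a `1`-cycle in it bounds a `2`-chain of the whole
surface, which is constant on the complement. -/
theorem IsPlanar.one_le_euler (hX : X.IsPlanar R) {S : Set A} {D : Finset X.Face} {E : Finset A}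
    (hE : ∀ e, e ∈ E ↔ X.blueFaceOf e ∈ D ∨ X.redFaceOf e ∈ D) (hne : E.Nonempty)
    (hD : ∀ F G, F ∉ D → G ∉ D → X.Reach S F G)
    (hS : ∀ e, e ∉ S → (X.blueFaceOf e ∈ D ↔ X.redFaceOf e ∈ D)) :
    E.card + 1 ≤ (E.image X.src ∪ E.image X.tgt).card + D.card := by
  set W := E.image X.src ∪ E.image X.tgt with hW
  have hsrcW : ∀ e ∈ E, X.src e ∈ W := fun e he =>
    Finset.mem_union_left _ (Finset.mem_image_of_mem _ he)
  have htgtW : ∀ e ∈ E, X.tgt e ∈ W := fun e he =>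
    Finset.mem_union_right _ (Finset.mem_image_of_mem _ he)
  -- The boundary maps of the cellular chain complex of the closure of `D`, and the augmentation.
  let d₁ : (E → ℝ) →ₗ[ℝ] (W → ℝ) := (Matrix.of fun (v : W) (e : E) =>
    (if X.tgt e = v then (1 : ℝ) else 0) - if X.src e = v then 1 else 0).mulVecLin
  let d₂ : (D → ℝ) →ₗ[ℝ] (E → ℝ) := (Matrix.of fun (e : E) (F : D) =>
    (if X.blueFaceOf e = F then (1 : ℝ) else 0) - if X.redFaceOf e = F then 1 else 0).mulVecLin
  let ε : (W → ℝ) →ₗ[ℝ] ℝ := ∑ v, LinearMap.proj v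
  have hd₁ : ∀ (f : E → ℝ) (v : W), d₁ f v = ∑ e : E,
      ((if X.tgt e = v then f e else 0) - if X.src e = v then f e else 0) := by
    intro f v
    simp only [d₁, Matrix.mulVecLin_apply, Matrix.mulVec, dotProduct, Matrix.of_apply, sub_mul,
      ite_mul, one_mul, zero_mul]
  have hε : ∀ g, ε g = ∑ v, g v := fun g => by simp [ε]
  have hεd : LinearMap.range d₁ ≤ LinearMap.ker ε := by
    rintro _ ⟨f, rfl⟩
    rw [LinearMap.mem_ker, hε]
    simp only [hd₁]
    rw [Finset.sum_comm]
    refine Finset.sum_eq_zero fun e _ => ?_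
    rw [Finset.sum_sub_distrib, sub_eq_zero]
    have h1 := Finset.sum_ite_eq (Finset.univ : Finset W) ⟨X.tgt e, htgtW e e.2⟩ fun _ => f e
    have h2 := Finset.sum_ite_eq (Finset.univ : Finset W) ⟨X.src e, hsrcW e e.2⟩ fun _ => f e
    simp only [Finset.mem_univ, if_true, Subtype.ext_iff] at h1 h2
    rw [h1, h2]
  -- Subtract from a bounding chain its constant value on the complement.
  have hker : LinearMap.ker d₁ ≤ LinearMap.range d₂ := by
    intro f hf
    rw [LinearMap.mem_ker] at hf
    set z : A →₀ ℝ := Finsupp.onFinset E (fun e => if h : e ∈ E then f ⟨e, h⟩ else 0)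
      (fun e he => by by_contra hc; exact he (dif_neg hc)) with hz
    have hzE : ∀ e : E, z e = f e := fun e => by
      rw [hz, Finsupp.onFinset_apply, dif_pos e.2]
    have hz0 : ∀ e, e ∉ E → z e = 0 := fun e he => by
      rw [hz, Finsupp.onFinset_apply, dif_neg he]
    have hmap : ∀ (t : A → V) v, z.mapDomain t v = ∑ e : E, if t e = v then f e else 0 := by
      intro t v
      rw [Finsupp.mapDomain,
        Finsupp.sum_of_support_subset (s := E) _ Finsupp.support_onFinset_subset _ (by simp),
        Finsupp.finsetSum_apply, ← Finset.sum_coe_sort]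
      exact Finset.sum_congr rfl fun e _ => by rw [Finsupp.single_apply, hzE]
    have hbd : z.mapDomain X.tgt = z.mapDomain X.src := by
      ext v
      rw [hmap, hmap]
      by_cases hv : v ∈ W
      · have := congrFun hf ⟨v, hv⟩
        rw [hd₁, Finset.sum_sub_distrib, Pi.zero_apply, sub_eq_zero] at this
        exact this
      · rw [Finset.sum_eq_zero fun (e : E) _ =>
            if_neg fun (hc : X.tgt e.1 = v) => hv (hc ▸ htgtW e.1 e.2),
          Finset.sum_eq_zero fun (e : E) _ =>
            if_neg fun (hc : X.src e.1 = v) => hv (hc ▸ hsrcW e.1 e.2)]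
    obtain ⟨n, hn⟩ := hX.exact z hbd
    have hconst : ∀ {F G}, X.Reach S F G → F ∉ D → n F = n G := by
      intro F G hFG hF
      have := hFG.mem_iff (D := {H | H ∉ D ∧ n H = n F}) fun e he => by
        have h1 := hS e he
        constructor
        · rintro ⟨h2, h3⟩
          have h4 := hn e
          rw [hz0 e (by rw [hE, not_or]; exact ⟨h2, fun h => h2 (h1.2 h)⟩)] at h4
          exact ⟨fun h => h2 (h1.2 h), by linarith⟩
        · rintro ⟨h2, h3⟩
          have h4 := hn e
          rw [hz0 e (by rw [hE, not_or]; exact ⟨fun h => h2 (h1.1 h), h2⟩)] at h4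
          exact ⟨fun h => h2 (h1.1 h), by linarith⟩
      exact (this.1 ⟨hF, rfl⟩).2.symm
    obtain ⟨c, hc⟩ : ∃ c, ∀ F, F ∉ D → n F = c := by
      by_cases hex : ∃ F, F ∉ D
      · obtain ⟨F₀, hF₀⟩ := hex
        exact ⟨n F₀, fun F hF => hconst (hD F F₀ hF hF₀) hF⟩
      · push Not at hex
        exact ⟨0, fun F hF => absurd (hex F) hF⟩
    have hval : ∀ F : X.Face, (∑ G : D, if F = G then n G - c else 0) = n F - c := by
      intro F
      by_cases hF : F ∈ D
      · have := Finset.sum_ite_eq (Finset.univ : Finset D) ⟨F, hF⟩ fun G => n G - c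
        simp only [Finset.mem_univ, if_true, Subtype.ext_iff] at this
        exact this
      · rw [Finset.sum_eq_zero fun (G : D) _ => if_neg fun (hFG : F = G) => hF (hFG ▸ G.2),
          hc F hF, sub_self]
    refine ⟨fun F => n F - c, funext fun e => ?_⟩
    simp only [d₂, Matrix.mulVecLin_apply, Matrix.mulVec, dotProduct, Matrix.of_apply, sub_mul,
      ite_mul, one_mul, zero_mul, Finset.sum_sub_distrib]
    rw [hval, hval, ← hzE, hn]
    ring
  have hWne : Nonempty W := by
    obtain ⟨e, he⟩ := hne
    exact ⟨⟨_, hsrcW e he⟩⟩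
  have hεsurj : LinearMap.range ε = ⊤ := by
    refine LinearMap.range_eq_top.2 fun r => ?_
    obtain ⟨v⟩ := hWne
    exact ⟨Pi.single v r, by rw [hε, Finset.sum_pi_single']; simp⟩
  have h1 := LinearMap.finrank_range_add_finrank_ker d₁
  have h2 := LinearMap.finrank_range_add_finrank_ker ε
  have h3 := (Submodule.finrank_mono hker).trans (LinearMap.finrank_range_le d₂)
  have h4 := Submodule.finrank_mono hεd
  rw [hεsurj, finrank_top] at h2
  simp only [Module.finrank_fintype_fun_eq_card, Fintype.card_coe, Module.finrank_self] at h1 h2 h3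
  omega

theorem HasCycleSum.finite_cyc_eq {σ : Equiv.Perm A} (h : HasCycleSum σ R) (e : A) :
    {f | σ.SameCycle f e}.Finite :=
  (boundary σ e).toFinset.finite_toSet.subset fun _ hf =>
    Finset.mem_coe.2 (h.mem_boundary_toFinset.2 (Equiv.Perm.SameCycle.symm hf))

theorem IsPlanar.finite_blue (hX : X.IsPlanar R) (D : Finset X.Face) :
    {e | X.blueFaceOf e ∈ D}.Finite := by
  refine Set.Finite.preimage' D.finite_toSet fun F _ => ?_
  rcases exists_eq_face F with ⟨e, rfl⟩ | ⟨e, rfl⟩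
  · exact (hX.blue_sum.finite_cyc_eq e).subset fun f hf => blueFaceOf_eq_iff.1 hf
  · exact Set.finite_empty.subset fun f hf => Sum.inl_ne_inr hf

theorem IsPlanar.finite_red (hX : X.IsPlanar R) (D : Finset X.Face) :
    {e | X.redFaceOf e ∈ D}.Finite := by
  refine Set.Finite.preimage' D.finite_toSet fun F _ => ?_
  rcases exists_eq_face F with ⟨e, rfl⟩ | ⟨e, rfl⟩
  · exact Set.finite_empty.subset fun f hf => Sum.inr_ne_inl hf
  · exact (hX.red_sum.finite_cyc_eq e).subset fun f hf => redFaceOf_eq_iff.1 hf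

/-- Counting the weights of the sides of all faces in `D`. -/
theorem IsPlanar.sum_sides (hX : X.IsPlanar R) {D : Finset X.Face} {B C : Finset A}
    (hB : ∀ e, e ∈ B ↔ X.blueFaceOf e ∈ D) (hC : ∀ e, e ∈ C ↔ X.redFaceOf e ∈ D) :
    ∑ e ∈ B, R e + ∑ e ∈ C, R e = 2 * D.card := by
  rw [← Finset.sum_fiberwise_of_maps_to (fun e he => (hB e).1 he),
    ← Finset.sum_fiberwise_of_maps_to (fun e he => (hC e).1 he), ← Finset.sum_add_distrib,
    Finset.sum_congr rfl (g := fun _ => (2 : ℝ)), Finset.sum_const, nsmul_eq_mul, mul_comm]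
  intro F hF
  rcases exists_eq_face F with ⟨e, rfl⟩ | ⟨e, rfl⟩
  · have h1 : B.filter (fun f => X.blueFaceOf f = X.blueFaceOf e) =
        (boundary X.blue e).toFinset := by
      ext f
      rw [Finset.mem_filter, hX.blue_sum.mem_boundary_toFinset, hB, blueFaceOf_eq_iff,
        Equiv.Perm.sameCycle_comm, and_iff_right_of_imp]
      intro h
      rwa [← blueFaceOf_eq_iff.2 h]
    have h2 : C.filter (fun f => X.redFaceOf f = X.blueFaceOf e) = ∅ :=
      Finset.filter_eq_empty_iff.2 fun f _ => Sum.inr_ne_inl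
    rw [h1, h2, hX.blue_sum.sum_boundary, Finset.sum_empty, add_zero]
  · have h1 : C.filter (fun f => X.redFaceOf f = X.redFaceOf e) =
        (boundary X.red e).toFinset := by
      ext f
      rw [Finset.mem_filter, hX.red_sum.mem_boundary_toFinset, hC, redFaceOf_eq_iff,
        Equiv.Perm.sameCycle_comm, and_iff_right_of_imp]
      intro h
      rwa [← redFaceOf_eq_iff.2 h]
    have h2 : B.filter (fun f => X.blueFaceOf f = X.redFaceOf e) = ∅ :=
      Finset.filter_eq_empty_iff.2 fun f _ => Sum.inl_ne_inr
    rw [h1, h2, hX.red_sum.sum_boundary, Finset.sum_empty, zero_add]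

theorem sum_filter_mem_eq {ι κ : Type*} (s : Finset ι) (t : Finset κ) (g : ι → κ) (f : ι → ℝ) :
    ∑ j ∈ t, ∑ i ∈ s with g i = j, f i = ∑ i ∈ s with g i ∈ t, f i := by
  rw [← Finset.sum_fiberwise_of_maps_to (t := t) (g := g) fun i hi => (Finset.mem_filter.1 hi).2]
  refine Finset.sum_congr rfl fun j hj => Finset.sum_congr ?_ fun _ _ => rfl
  ext i
  simp only [Finset.mem_filter]
  exact ⟨fun h => ⟨⟨h.1, h.2 ▸ hj⟩, h.2⟩, fun h => ⟨h.1.1, h.2⟩⟩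

/-- The Gauss-Bonnet inequality for a region `D` bounded by a simple closed curve `S`: the weight of
the curve is at least `2` plus the defects `1 - R` of the ends of arrows that emanate from the curve
into the region. Here `O` and `N` are sets of arrows inside `D` that start, respectively end, on the
curve. -/
theorem IsPlanar.gauss_bonnet (hX : X.IsPlanar R) {S : Finset A} {D : Finset X.Face}
    (hS : ∀ e, e ∉ S → (X.blueFaceOf e ∈ D ↔ X.redFaceOf e ∈ D))
    (hS' : ∀ e ∈ S, ¬ (X.blueFaceOf e ∈ D ↔ X.redFaceOf e ∈ D))
    (hD : ∀ F G, F ∉ D → G ∉ D → X.Reach (S : Set A) F G) (hne : S.Nonempty)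
    (hcard : (S.image X.src ∪ S.image X.tgt).card ≤ S.card) {O N : Finset A}
    (hO : ∀ e ∈ O, e ∉ S ∧ X.blueFaceOf e ∈ D ∧ X.src e ∈ S.image X.src ∪ S.image X.tgt)
    (hN : ∀ e ∈ N, e ∉ S ∧ X.blueFaceOf e ∈ D ∧ X.tgt e ∈ S.image X.src ∪ S.image X.tgt) :
    2 + ∑ e ∈ O, (1 - R e) + ∑ e ∈ N, (1 - R e) ≤ ∑ e ∈ S, R e := by
  set U := S.image X.src ∪ S.image X.tgt with hU
  set B := (hX.finite_blue D).toFinset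
  set C := (hX.finite_red D).toFinset
  have hB : ∀ e, e ∈ B ↔ X.blueFaceOf e ∈ D := fun e => Set.Finite.mem_toFinset _
  have hC : ∀ e, e ∈ C ↔ X.redFaceOf e ∈ D := fun e => Set.Finite.mem_toFinset _
  set E := B ∪ C with hEdef
  have hE : ∀ e, e ∈ E ↔ X.blueFaceOf e ∈ D ∨ X.redFaceOf e ∈ D := fun e => by
    rw [hEdef, Finset.mem_union, hB, hC]
  set W := E.image X.src ∪ E.image X.tgt with hW
  have hSE : S ⊆ E := fun e he => by
    rw [hE]
    have := hS' e he
    tauto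
  have hUW : U ⊆ W := Finset.union_subset_union (Finset.image_subset_image hSE)
    (Finset.image_subset_image hSE)
  -- The arrows with both faces in `D` are those which are not on the curve.
  set J := E \ S with hJ
  have hJmem : ∀ e, e ∈ J ↔ e ∉ S ∧ X.blueFaceOf e ∈ D := fun e => by
    rw [hJ, Finset.mem_sdiff, hE]
    have := hS e
    tauto
  have hBC : B ∩ C = J := by
    ext e
    rw [hJmem, Finset.mem_inter, hB, hC]
    have h1 := hS e
    have h2 := hS' e
    tauto
  have hfaces : ∑ e ∈ S, R e + 2 * ∑ e ∈ J, R e = 2 * D.card := by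
    rw [← hX.sum_sides hB hC, ← Finset.sum_union_inter, hBC, ← Finset.sum_sdiff hSE]
    ring
  -- At a vertex away from the curve, all arrows are inside the region.
  have hinner : ∀ v ∈ W \ U, ∑ e ∈ J with X.src e = v, (1 - R e) +
      ∑ e ∈ J with X.tgt e = v, (1 - R e) = 2 := by
    intro v hv
    obtain ⟨hvW, hvU⟩ := Finset.mem_sdiff.1 hv
    have hno : ∀ c, X.stepStart c = v → c.1 ∉ (S : Set A) := by
      rintro ⟨e, b⟩ hc he
      refine hvU ?_
      rw [← hc]
      cases b
      · exact Finset.mem_union_right _ (Finset.mem_image_of_mem _ he)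
      · exact Finset.mem_union_left _ (Finset.mem_image_of_mem _ he)
    obtain ⟨d, hd, hdE⟩ : ∃ d, X.stepStart d = v ∧ d.1 ∈ E := by
      rcases Finset.mem_union.1 hvW with h | h
      · obtain ⟨e, he, hev⟩ := Finset.mem_image.1 h
        exact ⟨(e, true), hev, he⟩
      · obtain ⟨e, he, hev⟩ := Finset.mem_image.1 h
        exact ⟨(e, false), hev, he⟩
    have hright : ∀ c, X.stepStart c = v → (X.rightFace c ∈ D ↔ c.1 ∈ J) := by
      rintro ⟨e, b⟩ hc
      have h1 := hno _ hc
      have h2 := hS e h1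
      rw [hJmem]
      cases b
      · exact ⟨fun h => ⟨h1, h2.2 h⟩, fun h => h2.1 h.2⟩
      · exact ⟨fun h => ⟨h1, h⟩, fun h => h.2⟩
    have hall : ∀ c, X.stepStart c = v → c.1 ∈ J := by
      intro c hc
      have h1 := (hX.reach_of_no_dart (d := d) (d' := c) (hd.trans hc.symm)
        fun c' hc' => hno c' (hc'.trans hd)).mem_iff (D := {F | F ∈ D}) hS
      exact (hright c hc).1 (h1.1 ((hright d hd).2 (Finset.mem_sdiff.2 ⟨hdE, hno d hd⟩)))
    obtain ⟨O', N', hO', hN', hsum⟩ := hX.vertex v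
    rw [← hsum]
    congr 2
    · ext e
      rw [Finset.mem_filter, hO']
      exact ⟨fun h => h.2, fun h => ⟨hall (e, true) h, h⟩⟩
    · ext e
      rw [Finset.mem_filter, hN']
      exact ⟨fun h => h.2, fun h => ⟨hall (e, false) h, h⟩⟩
  have hsumV : (2 * (W \ U).card : ℝ) = ∑ e ∈ J with X.src e ∈ W \ U, (1 - R e) +
      ∑ e ∈ J with X.tgt e ∈ W \ U, (1 - R e) := by
    rw [← sum_filter_mem_eq, ← sum_filter_mem_eq, ← Finset.sum_add_distrib,
      Finset.sum_congr rfl hinner, Finset.sum_const, nsmul_eq_mul, mul_comm]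
  have hnn : ∀ x, 0 ≤ 1 - R x := fun x => (sub_pos.2 (hX.lt_one x)).le
  -- The ends of arrows inside the region that are not counted at inner vertices lie on the curve.
  have h1 : ∑ e ∈ O, (1 - R e) ≤ ∑ e ∈ J with ¬ X.src e ∈ W \ U, (1 - R e) := by
    refine Finset.sum_le_sum_of_subset_of_nonneg (fun e he => ?_) fun x _ _ => hnn x
    obtain ⟨h1, h2, h3⟩ := hO e he
    exact Finset.mem_filter.2 ⟨(hJmem e).2 ⟨h1, h2⟩, fun hc => (Finset.mem_sdiff.1 hc).2 h3⟩
  have h2 : ∑ e ∈ N, (1 - R e) ≤ ∑ e ∈ J with ¬ X.tgt e ∈ W \ U, (1 - R e) := by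
    refine Finset.sum_le_sum_of_subset_of_nonneg (fun e he => ?_) fun x _ _ => hnn x
    obtain ⟨h1, h2, h3⟩ := hN e he
    exact Finset.mem_filter.2 ⟨(hJmem e).2 ⟨h1, h2⟩, fun hc => (Finset.mem_sdiff.1 hc).2 h3⟩
  have h3 := Finset.sum_filter_add_sum_filter_not J (fun e => X.src e ∈ W \ U) fun e => 1 - R e
  have h4 := Finset.sum_filter_add_sum_filter_not J (fun e => X.tgt e ∈ W \ U) fun e => 1 - R e
  have h5 : ∑ e ∈ J, (1 - R e) = J.card - ∑ e ∈ J, R e := by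
    rw [Finset.sum_sub_distrib, Finset.sum_const, nsmul_eq_mul, mul_one]
  have h6 := hX.one_le_euler hE (hne.mono hSE) hD hS
  have h7 : J.card + S.card = E.card := Finset.card_sdiff_add_card_eq_card hSE
  have h8 : (W \ U).card + U.card = W.card := Finset.card_sdiff_add_card_eq_card hUW
  have h9 : (J.card : ℝ) + 1 ≤ (W \ U).card + D.card := by
    rw [← hW] at h6
    exact_mod_cast (by omega : J.card + 1 ≤ (W \ U).card + D.card)
  linarith

end GaussBonnet

end SurfaceQuiver

namespace SurfaceQuiver

/-! ### Broken wheels in planar quivers -/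

section Shrubby

open Function Classical

variable {V : Type u} {A : Type v} {X : SurfaceQuiver V A} {R : A → ℝ} {a b : V} {p p' : List A}

theorem sum_one_sub_lt_one (hpos : ∀ e, 0 < R e) {s : Finset A}
    (hs : ∀ x ∈ s, ∀ y ∈ s, x = y) : ∑ e ∈ s, (1 - R e) < 1 := by
  rcases s.eq_empty_or_nonempty with rfl | ⟨x, hx⟩
  · simp
  · rw [Finset.eq_singleton_iff_unique_mem.2 ⟨hx, fun y hy => hs y hy x hx⟩, Finset.sum_singleton]
    linarith [hpos x]

/-- A simple closed curve has at most as many vertices as arrows. -/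
theorem SimplePair.card_vertices_le (h : X.SimplePair a b p p') :
    ((p.toFinset ∪ p'.toFinset).image X.src ∪ (p.toFinset ∪ p'.toFinset).image X.tgt).card ≤
      (p.toFinset ∪ p'.toFinset).card := by
  have closed : ∀ {q : List A}, q ≠ [] → X.IsPath a q a →
      (q.toFinset.image X.src ∪ q.toFinset.image X.tgt).card ≤ q.toFinset.card := by
    intro q hq hqa
    refine (Finset.card_le_card (Finset.union_subset subset_rfl ?_)).trans Finset.card_image_le
    intro v hv
    obtain ⟨e, he, rfl⟩ := Finset.mem_image.1 hv
    rcases hqa.tgt_eq_or (List.mem_toFinset.1 he) with h1 | ⟨f, hf, h1⟩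
    · obtain ⟨y, l, rfl⟩ := List.exists_cons_of_ne_nil hq
      rw [h1, ← hqa.1]
      exact Finset.mem_image_of_mem _ (by simp)
    · rw [← h1]
      exact Finset.mem_image_of_mem _ (List.mem_toFinset.2 hf)
  by_cases h0 : p = []
  · have hab : a = b := by simpa [h0, IsPath] using h.path
    have := closed (fun hc => h.ne (h0.trans hc.symm)) (by simpa only [← hab] using h.path')
    simpa [h0] using this
  by_cases h0' : p' = []
  · have hab : a = b := by simpa [h0', IsPath] using h.path'
    have := closed h0 (by simpa only [← hab] using h.path)
    simpa [h0'] using this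
  obtain ⟨y, q, hy⟩ := List.exists_cons_of_ne_nil h0
  obtain ⟨y', q', hy'⟩ := List.exists_cons_of_ne_nil h0'
  have hya : a ∈ p.toFinset.image X.src :=
    Finset.mem_image.2 ⟨y, by simp [hy], (hy ▸ h.path).1⟩
  have hya' : a ∈ p'.toFinset.image X.src :=
    Finset.mem_image.2 ⟨y', by simp [hy'], (hy' ▸ h.path').1⟩
  have hsub : (p.toFinset ∪ p'.toFinset).image X.src ∪ (p.toFinset ∪ p'.toFinset).image X.tgt ⊆
      insert b (p.toFinset.image X.src ∪ (p'.toFinset.image X.src).erase a) := by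
    have hsrc : ∀ e, e ∈ p ∨ e ∈ p' →
        X.src e ∈ p.toFinset.image X.src ∪ (p'.toFinset.image X.src).erase a := by
      rintro e (he | he)
      · exact Finset.mem_union_left _ (Finset.mem_image_of_mem _ (List.mem_toFinset.2 he))
      · by_cases hea : X.src e = a
        · rw [hea]
          exact Finset.mem_union_left _ hya
        · exact Finset.mem_union_right _ (Finset.mem_erase.2
            ⟨hea, Finset.mem_image_of_mem _ (List.mem_toFinset.2 he)⟩)
    intro v hv
    rcases Finset.mem_union.1 hv with hv | hv
    · obtain ⟨e, he, rfl⟩ := Finset.mem_image.1 hv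
      exact Finset.mem_insert_of_mem (hsrc e (by simpa using he))
    · obtain ⟨e, he, rfl⟩ := Finset.mem_image.1 hv
      have htgt : X.tgt e = b ∨ ∃ f, (f ∈ p ∨ f ∈ p') ∧ X.src f = X.tgt e := by
        rw [Finset.mem_union, List.mem_toFinset, List.mem_toFinset] at he
        rcases he with he | he
        · exact (h.path.tgt_eq_or he).imp_right fun ⟨f, hf, h1⟩ => ⟨f, Or.inl hf, h1⟩
        · exact (h.path'.tgt_eq_or he).imp_right fun ⟨f, hf, h1⟩ => ⟨f, Or.inr hf, h1⟩
      rcases htgt with h1 | ⟨f, hf, h1⟩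
      · rw [h1]
        exact Finset.mem_insert_self _ _
      · rw [← h1]
        exact Finset.mem_insert_of_mem (hsrc f hf)
  have h1 := Finset.card_le_card hsub
  have h2 := Finset.card_insert_le b (p.toFinset.image X.src ∪ (p'.toFinset.image X.src).erase a)
  have h3 := Finset.card_union_le (p.toFinset.image X.src) ((p'.toFinset.image X.src).erase a)
  have h4 := Finset.card_erase_add_one hya'
  have h5 := Finset.card_image_le (s := p.toFinset) (f := X.src)
  have h6 := Finset.card_image_le (s := p'.toFinset) (f := X.src)
  have h7 : (p.toFinset ∪ p'.toFinset).card = p.toFinset.card + p'.toFinset.card :=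
    Finset.card_union_of_disjoint (Finset.disjoint_left.2 fun e he he' =>
      h.disj e (List.mem_toFinset.1 he) (List.mem_toFinset.1 he'))
  omega

/-- If the paths of a simple pair contain no broken wheels of faces inside the region between
them, the weight of the curve is too small for the Gauss-Bonnet inequality. The
bounds along the two paths count the exits of the last arrows and the entrances of the first ones
independently; these may coincide, which costs less than `1` at each end. -/
theorem SimplePair.sum_lt (hX : X.IsPlanar R) (h : X.SimplePair a b p p')
    (hp : ∀ e ∈ p, ∀ g, X.red.SameCycle e g → ∀ u w, p ≠ u ++ (boundary X.red g).tail ++ w)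
    (hp' : ∀ e ∈ p', ∀ g, X.blue.SameCycle e g → ∀ u w, p' ≠ u ++ (boundary X.blue g).tail ++ w) :
    ∑ e ∈ p.toFinset ∪ p'.toFinset, R e < 2 +
      ∑ e ∈ exits X.red p.toFinset ∪ exits X.blue p'.toFinset, (1 - R e) +
      ∑ e ∈ entrances X.red p.toFinset ∪ entrances X.blue p'.toFinset, (1 - R e) := by
  by_cases h0 : p = []
  · have hab : a = b := by simpa [h0, IsPath] using h.path
    have := sum_lt_of_isPath_closed X.src_blue hX.blue_sum hX.pos hX.lt_one
      (by simpa only [← hab] using h.path') (fun hc => h.ne (h0.trans hc.symm)) h.src_nodup' hp'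
    simpa [h0, exits, entrances] using this
  by_cases h0' : p' = []
  · have hab : a = b := by simpa [h0', IsPath] using h.path'
    have := sum_lt_of_isPath_closed X.src_red hX.red_sum hX.pos hX.lt_one
      (by simpa only [← hab] using h.path) h0 h.src_nodup hp
    simpa [h0', exits, entrances] using this
  have h1 := sum_le_of_isPath X.src_red hX.red_sum hX.pos hX.lt_one h.path h.src_nodup
    (h.src_ne_end h0') hp
  have h2 := sum_le_of_isPath X.src_blue hX.blue_sum hX.pos hX.lt_one h.path' h.src_nodup'
    (h.src_ne_end' h0) hp'
  have h3 : ∑ e ∈ exits X.red p.toFinset ∩ exits X.blue p'.toFinset, (1 - R e) < 1 := by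
    have key : ∀ x ∈ exits X.red p.toFinset ∩ exits X.blue p'.toFinset,
        ∃ y ∈ p, X.red y = x ∧ X.tgt y = b := by
      intro x hx
      obtain ⟨hx, hx'⟩ := Finset.mem_inter.1 hx
      obtain ⟨⟨y, hy, rfl⟩, -⟩ := mem_exits.1 hx
      obtain ⟨⟨y', hy', hyy⟩, -⟩ := mem_exits.1 hx'
      rw [List.mem_toFinset] at hy hy'
      exact ⟨y, hy, rfl, h.tgt_meet y hy y' hy' (by rw [← X.src_red, ← hyy, X.src_blue])⟩
    refine sum_one_sub_lt_one hX.pos fun x₁ hx₁ x₂ hx₂ => ?_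
    obtain ⟨y₁, hy₁, rfl, hb₁⟩ := key x₁ hx₁
    obtain ⟨y₂, hy₂, rfl, hb₂⟩ := key x₂ hx₂
    rw [List.inj_on_of_nodup_map h.tgt_nodup hy₁ hy₂ (hb₁.trans hb₂.symm)]
  have h4 : ∑ e ∈ entrances X.red p.toFinset ∩ entrances X.blue p'.toFinset, (1 - R e) < 1 := by
    have key : ∀ x ∈ entrances X.red p.toFinset ∩ entrances X.blue p'.toFinset,
        X.red x ∈ p ∧ X.src (X.red x) = a := by
      intro x hx
      obtain ⟨hx, hx'⟩ := Finset.mem_inter.1 hx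
      have hy := List.mem_toFinset.1 (mem_entrances.1 hx).1
      have hy' := List.mem_toFinset.1 (mem_entrances.1 hx').1
      exact ⟨hy, h.src_meet _ hy _ hy' (by rw [X.src_red, X.src_blue])⟩
    refine sum_one_sub_lt_one hX.pos fun x₁ hx₁ x₂ hx₂ => ?_
    have k₁ := key x₁ hx₁
    have k₂ := key x₂ hx₂
    exact X.red.injective (List.inj_on_of_nodup_map h.src_nodup k₁.1 k₂.1 (k₁.2.trans k₂.2.symm))
  have h5 := Finset.sum_union_inter (s₁ := exits X.red p.toFinset) (s₂ := exits X.blue p'.toFinset)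
    (f := fun e => 1 - R e)
  have h6 := Finset.sum_union_inter (s₁ := entrances X.red p.toFinset)
    (s₂ := entrances X.blue p'.toFinset) (f := fun e => 1 - R e)
  have h7 : ∑ e ∈ p.toFinset ∪ p'.toFinset, R e = ∑ e ∈ p.toFinset, R e + ∑ e ∈ p'.toFinset, R e :=
    Finset.sum_union (Finset.disjoint_left.2 fun e he he' =>
      h.disj e (List.mem_toFinset.1 he) (List.mem_toFinset.1 he'))
  linarith

/-- If the region to the left of the curve `p * p'⁻¹` is finite with connected complement, then
`p` contains a broken wheel of a red face or `p'` contains one of a blue face, inside this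
region. -/
theorem SimplePair.exists_wheel_of_region (hX : X.IsPlanar R) (h : X.SimplePair a b p p')
    {D : Finset X.Face}
    (hD : ∀ e, e ∉ arrowSet p p' → (X.blueFaceOf e ∈ D ↔ X.redFaceOf e ∈ D))
    (hD' : ∀ F G, F ∉ D → G ∉ D → X.Reach (arrowSet p p') F G)
    (hp : ∀ e ∈ p, X.redFaceOf e ∈ D ∧ X.blueFaceOf e ∉ D)
    (hp' : ∀ e ∈ p', X.blueFaceOf e ∈ D ∧ X.redFaceOf e ∉ D) :
    ∃ g, ((∃ u w, p = u ++ (boundary X.red g).tail ++ w) ∧ X.redFaceOf g ∈ D) ∨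
      ((∃ u w, p' = u ++ (boundary X.blue g).tail ++ w) ∧ X.blueFaceOf g ∈ D) := by
  by_contra! hcon
  have hlt := h.sum_lt hX
    (fun e he g hg u w hpu => (hcon g).1 ⟨u, w, hpu⟩ (redFaceOf_eq_iff.2 hg ▸ (hp e he).1))
    (fun e he g hg u w hpu => (hcon g).2 ⟨u, w, hpu⟩ (blueFaceOf_eq_iff.2 hg ▸ (hp' e he).1))
  set S := p.toFinset ∪ p'.toFinset with hSdef
  have hS : ∀ e, e ∈ S ↔ e ∈ arrowSet p p' := fun e => by simp [hSdef]
  have hScoe : (S : Set A) = arrowSet p p' := Set.ext hS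
  have hsrcU : ∀ e, e ∈ arrowSet p p' → X.src e ∈ S.image X.src ∪ S.image X.tgt := fun e he =>
    Finset.mem_union_left _ (Finset.mem_image_of_mem _ ((hS e).2 he))
  have htgtU : ∀ e, e ∈ arrowSet p p' → X.tgt e ∈ S.image X.src ∪ S.image X.tgt := fun e he =>
    Finset.mem_union_right _ (Finset.mem_image_of_mem _ ((hS e).2 he))
  have hne : S.Nonempty := by
    by_contra hc
    rw [Finset.not_nonempty_iff_eq_empty, hSdef, Finset.union_eq_empty, List.toFinset_eq_empty_iff,
      List.toFinset_eq_empty_iff] at hc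
    exact h.ne (hc.1.trans hc.2.symm)
  have hred : ∀ e, X.redFaceOf (X.red e) = X.redFaceOf e := fun e =>
    redFaceOf_eq_iff.2 (Equiv.Perm.SameCycle.symm ⟨1, rfl⟩)
  have hblue : ∀ e, X.blueFaceOf (X.blue e) = X.blueFaceOf e := fun e =>
    blueFaceOf_eq_iff.2 (Equiv.Perm.SameCycle.symm ⟨1, rfl⟩)
  refine hlt.not_ge (hX.gauss_bonnet (D := D) ?_ ?_ ?_ hne h.card_vertices_le ?_ ?_)
  · intro e he
    exact hD e fun hc => he ((hS e).2 hc)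
  · intro e he hiff
    rcases (hS e).1 he with he | he
    · exact (hp e he).2 (hiff.2 (hp e he).1)
    · exact (hp' e he).2 (hiff.1 (hp' e he).1)
  · rwa [hScoe]
  · intro e he
    rw [hS]
    rcases Finset.mem_union.1 he with he | he
    · obtain ⟨⟨y, hy, rfl⟩, hn⟩ := mem_exits.1 he
      rw [List.mem_toFinset] at hy hn
      have hnS : X.red y ∉ arrowSet p p' := by
        rintro (hc | hc)
        · exact hn hc
        · exact h.tgt_ne_src y hy _ hc (X.src_red y).symm
      refine ⟨hnS, (hD _ hnS).2 ?_, ?_⟩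
      · rw [hred]
        exact (hp y hy).1
      · rw [X.src_red]
        exact htgtU y (Or.inl hy)
    · obtain ⟨⟨y, hy, rfl⟩, hn⟩ := mem_exits.1 he
      rw [List.mem_toFinset] at hy hn
      have hnS : X.blue y ∉ arrowSet p p' := by
        rintro (hc | hc)
        · exact h.src_ne_tgt _ hc y hy (X.src_blue y)
        · exact hn hc
      refine ⟨hnS, ?_, ?_⟩
      · rw [hblue]
        exact (hp' y hy).1
      · rw [X.src_blue]
        exact htgtU y (Or.inr hy)
  · intro e he
    rw [hS]
    rcases Finset.mem_union.1 he with he | he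
    · obtain ⟨hy, hn⟩ := mem_entrances.1 he
      rw [List.mem_toFinset] at hy hn
      have hnS : e ∉ arrowSet p p' := by
        rintro (hc | hc)
        · exact hn hc
        · exact h.src_ne_tgt _ hy e hc (X.src_red e)
      refine ⟨hnS, (hD _ hnS).2 ?_, ?_⟩
      · rw [← hred]
        exact (hp _ hy).1
      · rw [← X.src_red]
        exact hsrcU _ (Or.inl hy)
    · obtain ⟨hy, hn⟩ := mem_entrances.1 he
      rw [List.mem_toFinset] at hy hn
      have hnS : e ∉ arrowSet p p' := by
        rintro (hc | hc)
        · exact h.tgt_ne_src e hc _ hy (X.src_blue e).symm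
        · exact hn hc
      refine ⟨hnS, ?_, ?_⟩
      · rw [← hblue]
        exact (hp' _ hy).1
      · rw [← X.src_blue]
        exact hsrcU _ (Or.inr hy)

theorem encloses_of_mem {S : Set A} {D : Finset X.Face}
    (hD : ∀ e, e ∉ S → (X.blueFaceOf e ∈ D ↔ X.redFaceOf e ∈ D)) {F : X.Face} (hF : F ∈ D) :
    X.Encloses S F :=
  D.finite_toSet.subset fun _ hG => (Reach.mem_iff (D := {F | F ∈ D}) hD hG).1 hF

theorem SimplePair.exists_wheel (hX : X.IsPlanar R) (h : X.SimplePair a b p p') :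
    ∃ e, (X.ContainsBrokenWheel a p e ∨ X.ContainsBrokenWheel a p' e) ∧ X.InRegion p p' e := by
  have hb : ∀ e, 1 < minimalPeriod X.blue e := fun e =>
    one_lt_two.trans (hX.blue_sum.two_lt_period hX.lt_one e)
  have hr : ∀ e, 1 < minimalPeriod X.red e := fun e =>
    one_lt_two.trans (hX.red_sum.two_lt_period hX.lt_one e)
  obtain ⟨D, hD, hD', ⟨h1, h2⟩ | ⟨h1, h2⟩⟩ := h.exists_region hX
  · obtain ⟨g, ⟨h3, h4⟩ | ⟨h3, h4⟩⟩ := h.exists_wheel_of_region hX hD hD' h1 h2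
    · exact ⟨g, Or.inl ((containsBrokenWheel_iff hb hr h.path).2 (Or.inr h3)),
        Or.inr (encloses_of_mem hD h4)⟩
    · exact ⟨g, Or.inr ((containsBrokenWheel_iff hb hr h.path').2 (Or.inl h3)),
        Or.inl (encloses_of_mem hD h4)⟩
  · obtain ⟨g, ⟨h3, h4⟩ | ⟨h3, h4⟩⟩ := h.symm.exists_wheel_of_region hX
      (by rwa [arrowSet_comm]) (by rwa [arrowSet_comm]) h1 h2
    · exact ⟨g, Or.inr ((containsBrokenWheel_iff hb hr h.path').2 (Or.inr h3)),
        Or.inr (encloses_of_mem hD h4)⟩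
    · exact ⟨g, Or.inl ((containsBrokenWheel_iff hb hr h.path).2 (Or.inl h3)),
        Or.inl (encloses_of_mem hD h4)⟩

/-- Induction on the total length of the two paths: a pair which is not minimal contains a shorter
pair, whose region is contained in the given one. -/
theorem IsPlanar.exists_wheel (hX : X.IsPlanar R) (hp : X.IsPath a p b) (hp' : X.IsPath a p' b)
    (hne : p ≠ p') :
    ∃ e, (X.ContainsBrokenWheel a p e ∨ X.ContainsBrokenWheel a p' e) ∧ X.InRegion p p' e := by
  have hb : ∀ e, 1 < minimalPeriod X.blue e := fun e =>
    one_lt_two.trans (hX.blue_sum.two_lt_period hX.lt_one e)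
  have hr : ∀ e, 1 < minimalPeriod X.red e := fun e =>
    one_lt_two.trans (hX.red_sum.two_lt_period hX.lt_one e)
  induction hl : p.length + p'.length using Nat.strong_induction_on generalizing a b p p' with
  | _ n ih =>
  by_contra hcon
  refine hcon (IsMinimalPair.simplePair ⟨hp, hp', hne, fun c d q q' hq hq' hqp hqp' hlt => ?_⟩
    |>.exists_wheel hX)
  by_contra hqq
  obtain ⟨e, he, hreg⟩ := ih _ (hl ▸ hlt) hq hq' hqq rfl
  have hmono : ∀ {r s : List A} {i j k : V}, X.IsPath i r j → X.IsPath k s b → r <:+: s →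
      X.ContainsBrokenWheel i r e → X.ContainsBrokenWheel k s e := by
    rintro r s i j k hr' hs ⟨l, m, rfl⟩ hw
    rw [containsBrokenWheel_iff hb hr hr'] at hw
    rw [containsBrokenWheel_iff hb hr hs]
    rcases hw with ⟨u, w, rfl⟩ | ⟨u, w, rfl⟩
    · exact Or.inl ⟨l ++ u, w ++ m, by simp⟩
    · exact Or.inr ⟨l ++ u, w ++ m, by simp⟩
  refine hcon ⟨e, ?_, hreg.mono fun x hx => ?_⟩
  · rcases he with he | he
    · exact hqp.imp (fun h1 => hmono hq hp h1 he) (fun h1 => hmono hq hp' h1 he)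
    · exact hqp'.imp (fun h1 => hmono hq' hp h1 he) (fun h1 => hmono hq' hp' h1 he)
  · rcases hx with hx | hx
    · exact hqp.imp (fun h1 => h1.subset hx) (fun h1 => h1.subset hx)
    · exact hqp'.imp (fun h1 => h1.subset hx) (fun h1 => h1.subset hx)

end Shrubby

end SurfaceQuiver

namespace SurfaceQuiver

/-! ### The universal cover is planar -/

section Boundaries

open Classical

variable {V : Type u} {A : Type v}

/-- The `1`-chains that bound a finite `2`-chain. -/
def boundaries (X : SurfaceQuiver V A) : Submodule ℝ (A →₀ ℝ) where
  carrier := {z | ∃ n : X.Face →₀ ℝ, ∀ e, z e = n (X.blueFaceOf e) - n (X.redFaceOf e)}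
  zero_mem' := ⟨0, by simp⟩
  add_mem' := by
    rintro z z' ⟨n, hn⟩ ⟨n', hn'⟩
    refine ⟨n + n', fun e => ?_⟩
    rw [Finsupp.add_apply, Finsupp.add_apply, Finsupp.add_apply, hn, hn']
    ring
  smul_mem' := by
    rintro c z ⟨n, hn⟩
    refine ⟨c • n, fun e => ?_⟩
    rw [Finsupp.smul_apply, Finsupp.smul_apply, Finsupp.smul_apply, hn, smul_sub]

theorem blueFaceOf_ne_redFaceOf {X : SurfaceQuiver V A} (e f : A) :
    X.blueFaceOf e ≠ X.redFaceOf f := Sum.inl_ne_inr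

theorem pathChain_blue_mem {X : SurfaceQuiver V A} {e : A}
    (h : 0 < Function.minimalPeriod X.blue e) :
    pathChain (boundary X.blue e) ∈ X.boundaries := by
  refine ⟨Finsupp.single (X.blueFaceOf e) 1, fun f => ?_⟩
  rw [pathChain_apply (nodup_boundary _ _), Finsupp.single_apply, Finsupp.single_apply,
    if_neg (blueFaceOf_ne_redFaceOf e f), sub_zero]
  simp only [mem_boundary h, blueFaceOf_eq_iff]

theorem pathChain_red_mem {X : SurfaceQuiver V A} {e : A}
    (h : 0 < Function.minimalPeriod X.red e) :
    pathChain (boundary X.red e) ∈ X.boundaries := by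
  refine ⟨Finsupp.single (X.redFaceOf e) (-1), fun f => ?_⟩
  rw [pathChain_apply (nodup_boundary _ _), Finsupp.single_apply, Finsupp.single_apply,
    if_neg (blueFaceOf_ne_redFaceOf f e).symm, zero_sub]
  simp only [mem_boundary h, redFaceOf_eq_iff]
  split_ifs <;> simp

theorem pathChain_append (p q : List A) : pathChain (p ++ q) = pathChain p + pathChain q := by
  simp [pathChain]

end Boundaries

section CoverPlanar

open Function Classical

variable {I : Type u} {E : Type v} {Q : SurfaceQuiver I E}

theorem isWalk_append {u w : List (E × Bool)} {i j : I} :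
    Q.IsWalk i (u ++ w) j ↔ ∃ k, Q.IsWalk i u k ∧ Q.IsWalk k w j := by
  induction u generalizing i with
  | nil => simp [IsWalk]
  | cons x u ih =>
    simp only [List.cons_append, IsWalk, ih]
    constructor
    · rintro ⟨h, k, h1, h2⟩
      exact ⟨k, ⟨h, h1⟩, h2⟩
    · rintro ⟨k, ⟨h, h1⟩, h2⟩
      exact ⟨h, k, h1, h2⟩

theorem IsWalk.start_unique {w : List (E × Bool)} {i i' j : I} (h : Q.IsWalk i w j)
    (h' : Q.IsWalk i' w j) : i = i' := by
  cases w with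
  | nil => exact Eq.trans h (Eq.symm h')
  | cons x w => exact h.1.symm.trans h'.1

theorem IsWalk.end_unique {w : List (E × Bool)} {i j j' : I} (h : Q.IsWalk i w j)
    (h' : Q.IsWalk i w j') : j = j' := by
  induction w generalizing i with
  | nil => exact Eq.trans (Eq.symm h) h'
  | cons x w ih => exact ih h.2 h'.2

variable {o : I}

/-- The vertex of the universal cover given by a walk. -/
def ofWalk {o j : I} (w : List (E × Bool)) (h : Q.IsWalk o w j) : Q.CoverVertex o :=
  ⟨j, Quot.mk _ ⟨w, h⟩⟩

theorem exists_ofWalk (a : Q.CoverVertex o) : ∃ (w : List (E × Bool)) (h : Q.IsWalk o w a.1),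
    a = ofWalk w h := by
  obtain ⟨j, γ⟩ := a
  induction γ using Quot.ind with
  | mk w => exact ⟨w.1, w.2, rfl⟩

theorem ofWalk_congr {w w' : List (E × Bool)} {j j' : I} (h : Q.IsWalk o w j)
    (h' : Q.IsWalk o w' j') (hw : w = w') : ofWalk w h = ofWalk w' h' := by
  subst hw
  obtain rfl := h.end_unique h'
  rfl

theorem ofWalk_elementary {w w' : List (E × Bool)} {j : I} (h : Q.IsWalk o w j)
    (h' : Q.IsWalk o w' j) (hw : Q.Elementary w w') : ofWalk w h = ofWalk w' h' :=
  congrArg (Sigma.mk j) (Quot.sound hw)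

/-- Extend a vertex of the cover by a signed arrow. If the arrow does not start at the vertex,
nothing happens. -/
noncomputable def move (a : Q.CoverVertex o) (x : E × Bool) : Q.CoverVertex o :=
  if h : Q.stepStart x = a.1 then CoverVertex.extend Q a x h else a

/-- The end point of the lift of a walk starting at a given vertex of the cover. -/
noncomputable def walkEnd (a : Q.CoverVertex o) (w : List (E × Bool)) : Q.CoverVertex o :=
  w.foldl move a

/-- The `1`-chain of the lift of a signed arrow. -/
noncomputable def stepChain (a : Q.CoverVertex o) :
    (x : E × Bool) → Q.stepStart x = a.1 → Q.CoverArrow o →₀ ℝ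
  | (e, true), h => Finsupp.single ⟨(e, a), h.symm⟩ 1
  | (e, false), h => -Finsupp.single ⟨(e, CoverVertex.extend Q a (e, false) h), rfl⟩ 1

/-- The `1`-chain of the lift of a walk starting at a given vertex of the cover. -/
noncomputable def walkChain : Q.CoverVertex o → List (E × Bool) → Q.CoverArrow o →₀ ℝ
  | _, [] => 0
  | a, x :: w => (if h : Q.stepStart x = a.1 then stepChain a x h else 0) + walkChain (move a x) w

theorem walkEnd_append (a : Q.CoverVertex o) (u w : List (E × Bool)) :
    walkEnd a (u ++ w) = walkEnd (walkEnd a u) w := List.foldl_append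

theorem walkChain_append (a : Q.CoverVertex o) (u w : List (E × Bool)) :
    walkChain a (u ++ w) = walkChain a u + walkChain (walkEnd a u) w := by
  induction u generalizing a with
  | nil => simp [walkChain, walkEnd]
  | cons x u ih =>
    rw [List.cons_append, walkChain, walkChain, ih, add_assoc]
    rfl

theorem move_of_start {a : Q.CoverVertex o} {x : E × Bool} (h : Q.stepStart x = a.1) :
    move a x = CoverVertex.extend Q a x h := dif_pos h

theorem walkChain_singleton {a : Q.CoverVertex o} {x : E × Bool} (h : Q.stepStart x = a.1) :
    walkChain a [x] = stepChain a x h := by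
  rw [walkChain, walkChain, dif_pos h, add_zero]

theorem walkEnd_ofWalk {u w : List (E × Bool)} {j k : I} (h : Q.IsWalk o w j)
    (h' : Q.IsWalk o (w ++ u) k) : walkEnd (ofWalk w h) u = ofWalk (w ++ u) h' := by
  induction u generalizing w j with
  | nil => exact ofWalk_congr _ _ (by simp)
  | cons x u ih =>
    obtain ⟨l, hl, hx⟩ := isWalk_append.1 h'
    obtain rfl := h.end_unique hl
    have h1 : Q.stepStart x = (ofWalk w h).1 := hx.1
    rw [walkEnd, List.foldl_cons, move_of_start h1]
    refine (ih (h.concat hx.1) (by simpa using h')).trans ?_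
    exact ofWalk_congr _ _ (by simp)

theorem stepStart_stepInv (x : E × Bool) : Q.stepStart (stepInv x) = Q.stepEnd x := by
  obtain ⟨e, b⟩ := x
  cases b <;> rfl

/-! The lifts of `blue` and `red`. -/

section Lift

variable {σ : Equiv.Perm E} {hσ : ∀ e, Q.src (σ e) = Q.tgt e}

theorem liftPerm_pow_fst (k : ℕ) (x : Q.CoverArrow o) :
    ((Q.liftPerm σ hσ o ^ k) x).1.1 = (σ ^ k) x.1.1 := by
  induction k with
  | zero => rfl
  | succ k ih =>
    rw [pow_succ', pow_succ', Equiv.Perm.mul_apply, Equiv.Perm.mul_apply, ← ih]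
    rfl

/-- Walking along the boundary of a face lifts to walking along the boundary of a face of the
cover. -/
theorem walk_face (n : ℕ) (x : Q.CoverArrow o) :
    walkEnd x.1.2 ((List.range n).map fun k => ((σ ^ k) x.1.1, true)) =
        ((Q.liftPerm σ hσ o ^ n) x).1.2 ∧
      walkChain x.1.2 ((List.range n).map fun k => ((σ ^ k) x.1.1, true)) =
        pathChain ((List.range n).map fun k => (Q.liftPerm σ hσ o ^ k) x) := by
  induction n with
  | zero => exact ⟨rfl, by simp [walkChain, pathChain]⟩
  | succ n ih =>
    have hst : Q.stepStart ((σ ^ n) x.1.1, true) = ((Q.liftPerm σ hσ o ^ n) x).1.2.1 := by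
      rw [((Q.liftPerm σ hσ o ^ n) x).2, liftPerm_pow_fst]
      rfl
    have hx : ∀ (y : Q.CoverArrow o) (e : E) (he : e = y.1.1)
        (h : Q.stepStart (e, true) = y.1.2.1),
        CoverVertex.extend Q y.1.2 (e, true) h = (Q.liftPerm σ hσ o y).1.2 ∧
          stepChain y.1.2 (e, true) h = Finsupp.single y 1 := by
      rintro y e rfl h
      exact ⟨rfl, rfl⟩
    have h1 := hx _ _ (liftPerm_pow_fst n x).symm hst
    rw [List.range_succ, List.map_append, List.map_append, walkEnd_append, walkChain_append,
      pathChain_append, ih.1, ih.2, List.map_singleton, walkChain_singleton hst, h1.2,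
      List.map_singleton, pow_succ', Equiv.Perm.mul_apply, ← h1.1, ← move_of_start hst]
    exact ⟨rfl, by simp [pathChain]⟩

/-- Since the boundaries of faces are null-homotopic, faces lift homeomorphically. -/
theorem minimalPeriod_liftPerm
    (hel : ∀ (a : List (E × Bool)) e,
      Q.Elementary a (a ++ (boundary σ e).map fun f => (f, true))) (x : Q.CoverArrow o) :
    minimalPeriod (Q.liftPerm σ hσ o) x = minimalPeriod σ x.1.1 := by
  refine Nat.dvd_antisymm (IsPeriodicPt.minimalPeriod_dvd ?_) (IsPeriodicPt.minimalPeriod_dvd ?_)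
  · rw [IsPeriodicPt, IsFixedPt, Equiv.Perm.iterate_eq_pow]
    refine Subtype.ext (Prod.ext ?_ ?_)
    · rw [liftPerm_pow_fst, pow_minimalPeriod_apply]
    · rw [← (walk_face _ x).1]
      obtain ⟨w, hw, hx⟩ := exists_ofWalk x.1.2
      have hb : ((List.range (minimalPeriod σ x.1.1)).map fun k => ((σ ^ k) x.1.1, true)) =
          (boundary σ x.1.1).map fun f => (f, true) := by
        rw [boundary, List.map_map]
        rfl
      have hwalk : ∀ n, Q.IsWalk o (w ++ (List.range n).map fun k => ((σ ^ k) x.1.1, true))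
          (Q.src ((σ ^ n) x.1.1)) := by
        intro n
        induction n with
        | zero => simpa [x.2] using hw
        | succ n ih =>
          rw [List.range_succ, List.map_append, ← List.append_assoc, pow_succ',
            Equiv.Perm.mul_apply, hσ]
          exact ih.concat rfl
      have h1 := hwalk (minimalPeriod σ x.1.1)
      rw [pow_minimalPeriod_apply, ← x.2] at h1
      rw [hx, walkEnd_ofWalk hw h1]
      exact (ofWalk_elementary hw h1 (hb ▸ hel w x.1.1)).symm
  · rw [IsPeriodicPt, IsFixedPt, Equiv.Perm.iterate_eq_pow, ← liftPerm_pow_fst (hσ := hσ),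
      pow_minimalPeriod_apply]

theorem HasCycleSum.liftPerm {R : E → ℝ} (h : HasCycleSum σ R)
    (hel : ∀ (a : List (E × Bool)) e,
      Q.Elementary a (a ++ (boundary σ e).map fun f => (f, true))) :
    HasCycleSum (Q.liftPerm σ hσ o) fun x => R x.1.1 := by
  intro x
  rw [minimalPeriod_liftPerm hel, ← h x.1.1]
  simp only [liftPerm_pow_fst]

theorem walkChain_boundary
    (hel : ∀ (a : List (E × Bool)) e,
      Q.Elementary a (a ++ (boundary σ e).map fun f => (f, true))) (x : Q.CoverArrow o) :
    walkChain x.1.2 ((boundary σ x.1.1).map fun f => (f, true)) =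
      pathChain (boundary (Q.liftPerm σ hσ o) x) := by
  rw [boundary, List.map_map, boundary, minimalPeriod_liftPerm hel]
  exact (walk_face _ x).2

end Lift

theorem elementary_blue (a : List (E × Bool)) (e : E) :
    Q.Elementary a (a ++ (boundary Q.blue e).map fun f => (f, true)) := by
  simpa using Elementary.blue (Q := Q) a [] e

theorem elementary_red (a : List (E × Bool)) (e : E) :
    Q.Elementary a (a ++ (boundary Q.red e).map fun f => (f, true)) := by
  simpa using Elementary.red (Q := Q) a [] e

/-- The base vertex of the cover. -/
def baseVertex (Q : SurfaceQuiver I E) (o : I) : Q.CoverVertex o := ofWalk [] (rfl : o = o)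

theorem walkEnd_baseVertex {w : List (E × Bool)} {j : I} (h : Q.IsWalk o w j) :
    walkEnd (Q.baseVertex o) w = ofWalk w h :=
  walkEnd_ofWalk (w := []) (rfl : o = o) h

/-- Inserting a null-homotopic loop into a walk changes its chain by the chain of the loop. -/
theorem walkChain_insert {a b c : List (E × Bool)} {j : I} (h : Q.IsWalk o (a ++ b) j)
    (h' : Q.IsWalk o (a ++ c ++ b) j) (hel : Q.Elementary a (a ++ c)) :
    ∃ v : Q.CoverVertex o, Q.IsWalk v.1 c v.1 ∧
      walkChain (Q.baseVertex o) (a ++ c ++ b) =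
        walkChain (Q.baseVertex o) (a ++ b) + walkChain v c := by
  obtain ⟨k, hak, hkb⟩ := isWalk_append.1 h
  obtain ⟨k', hack, hkb'⟩ := isWalk_append.1 h'
  obtain rfl := hkb.start_unique hkb'
  obtain ⟨l, hal, hlc⟩ := isWalk_append.1 hack
  obtain rfl := hak.end_unique hal
  refine ⟨ofWalk a hak, hlc, ?_⟩
  rw [walkChain_append, walkChain_append, walkChain_append, walkEnd_baseVertex hak,
    walkEnd_baseVertex hack, ← ofWalk_elementary hak hack hel]
  abel

theorem src_eq_of_isWalk_boundary {σ : Equiv.Perm E} {e : E} (h0 : 0 < minimalPeriod σ e) {i j : I}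
    (h : Q.IsWalk i ((boundary σ e).map fun f => (f, true)) j) : Q.src e = i := by
  obtain ⟨n, hn⟩ := Nat.exists_eq_succ_of_ne_zero h0.ne'
  rw [boundary, hn, List.range_succ_eq_map] at h
  exact h.1

/-- Homotopic walks have homologous lifts. -/
theorem Elementary.walkChain_sub_mem (hb : ∀ e, 0 < minimalPeriod Q.blue e)
    (hr : ∀ e, 0 < minimalPeriod Q.red e) {w w' : List (E × Bool)} {j : I}
    (h : Q.IsWalk o w j) (h' : Q.IsWalk o w' j) (hel : Q.Elementary w w') :
    walkChain (Q.baseVertex o) w' - walkChain (Q.baseVertex o) w ∈ (Q.cover o).boundaries := by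
  cases hel with
  | cancel a b x =>
    obtain ⟨v, hv, hc⟩ := walkChain_insert h h' (by simpa using Elementary.cancel (Q := Q) a [] x)
    rw [hc, add_sub_cancel_left]
    have h1 : Q.stepStart x = v.1 := hv.1
    have h2 : Q.stepStart (stepInv x) = (CoverVertex.extend Q v x h1).1 := stepStart_stepInv x
    rw [← List.singleton_append, walkChain_append, walkChain_singleton h1]
    have h3 : walkEnd v [x] = CoverVertex.extend Q v x h1 := move_of_start h1
    rw [h3, walkChain_singleton h2]
    convert Submodule.zero_mem _
    obtain ⟨e, b'⟩ := x
    cases b'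
    · exact neg_add_cancel _
    · have h4 : (⟨(e, v), h1.symm⟩ : Q.CoverArrow o) =
          ⟨(e, CoverVertex.extend Q (CoverVertex.extend Q v (e, true) h1) (e, false) h2), rfl⟩ :=
        Subtype.ext (Prod.ext rfl (CoverVertex.extend_extend Q v (e, true) h1 h2).symm)
      exact add_neg_eq_zero.2 (congrArg (fun y => Finsupp.single y (1 : ℝ)) h4)
  | blue a b e =>
    obtain ⟨v, hv, hc⟩ := walkChain_insert h h' (elementary_blue a e)
    have he := src_eq_of_isWalk_boundary (hb e) hv
    have h1 := walkChain_boundary (σ := Q.blue) (hσ := Q.src_blue) elementary_blue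
      (⟨(e, v), he.symm⟩ : Q.CoverArrow o)
    rw [hc, add_sub_cancel_left]
    refine h1 ▸ pathChain_blue_mem (X := Q.cover o) ?_
    exact (minimalPeriod_liftPerm (hσ := Q.src_blue) elementary_blue _).symm ▸ hb e
  | red a b e =>
    obtain ⟨v, hv, hc⟩ := walkChain_insert h h' (elementary_red a e)
    have he := src_eq_of_isWalk_boundary (hr e) hv
    have h1 := walkChain_boundary (σ := Q.red) (hσ := Q.src_red) elementary_red
      (⟨(e, v), he.symm⟩ : Q.CoverArrow o)
    rw [hc, add_sub_cancel_left]
    refine h1 ▸ pathChain_red_mem (X := Q.cover o) ?_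
    exact (minimalPeriod_liftPerm (hσ := Q.src_red) elementary_red _).symm ▸ hr e

/-- The homology class, modulo boundaries, of the lifts of the walks representing a vertex of the
cover. -/
noncomputable def potential (hb : ∀ e, 0 < minimalPeriod Q.blue e)
    (hr : ∀ e, 0 < minimalPeriod Q.red e) (a : Q.CoverVertex o) :
    (Q.CoverArrow o →₀ ℝ) ⧸ (Q.cover o).boundaries :=
  Quot.lift (fun w : Q.Walk o a.1 => (Q.cover o).boundaries.mkQ (walkChain (Q.baseVertex o) w.1))
    (fun w w' h => ((Submodule.Quotient.eq _).2
      (Elementary.walkChain_sub_mem hb hr w.2 w'.2 h)).symm) a.2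

theorem potential_target (hb : ∀ e, 0 < minimalPeriod Q.blue e)
    (hr : ∀ e, 0 < minimalPeriod Q.red e) (x : Q.CoverArrow o) :
    potential hb hr (CoverArrow.target Q x) =
      potential hb hr x.1.2 + (Q.cover o).boundaries.mkQ (Finsupp.single x 1) := by
  obtain ⟨⟨e, j, γ⟩, hx⟩ := x
  induction γ using Quot.ind with
  | mk w =>
    change (Q.cover o).boundaries.mkQ (walkChain (Q.baseVertex o) (w.1 ++ [(e, true)])) =
      (Q.cover o).boundaries.mkQ (walkChain (Q.baseVertex o) w.1) + _
    have h1 : Q.stepStart (e, true) = (ofWalk w.1 w.2).1 := hx.symm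
    rw [walkChain_append, walkEnd_baseVertex w.2, map_add, walkChain_singleton h1]
    rfl

/-- The first homology of the cover vanishes: the class of a `1`-chain modulo boundaries is
computed from its end points by the potential. -/
theorem cover_exact (hb : ∀ e, 0 < minimalPeriod Q.blue e)
    (hr : ∀ e, 0 < minimalPeriod Q.red e) (z : Q.CoverArrow o →₀ ℝ)
    (hz : z.mapDomain (Q.cover o).tgt = z.mapDomain (Q.cover o).src) :
    z ∈ (Q.cover o).boundaries := by
  have key : ∀ z : Q.CoverArrow o →₀ ℝ,
      Finsupp.linearCombination ℝ (potential hb hr) (z.mapDomain (Q.cover o).tgt) =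
      Finsupp.linearCombination ℝ (potential hb hr) (z.mapDomain (Q.cover o).src) +
        (Q.cover o).boundaries.mkQ z := by
    intro z
    induction z using Finsupp.induction_linear with
    | zero => simp
    | add f g hf hg =>
      rw [Finsupp.mapDomain_add, Finsupp.mapDomain_add, map_add, map_add, map_add, hf, hg]
      abel
    | single x r =>
      rw [Finsupp.mapDomain_single, Finsupp.mapDomain_single, Finsupp.linearCombination_single,
        Finsupp.linearCombination_single, ← mul_one r, ← smul_eq_mul r 1, ← Finsupp.smul_single,
        map_smul, smul_eq_mul, mul_one, ← smul_add]
      exact congrArg (r • ·) (potential_target hb hr x)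
  have h1 := key z
  rw [hz, left_eq_add] at h1
  exact (Submodule.Quotient.mk_eq_zero _).1 h1

theorem eqvGen_extend (a : Q.CoverVertex o) (x : E × Bool) (h : Q.stepStart x = a.1) :
    Relation.EqvGen (fun a b => ∃ e, (Q.cover o).src e = a ∧ (Q.cover o).tgt e = b) a
      (CoverVertex.extend Q a x h) := by
  obtain ⟨e, b⟩ := x
  cases b
  · exact Relation.EqvGen.symm _ _ (Relation.EqvGen.rel _ _ ⟨⟨(e, _), rfl⟩, rfl,
      CoverVertex.extend_extend Q a (e, false) h rfl⟩)
  · exact Relation.EqvGen.rel _ _ ⟨⟨(e, a), h.symm⟩, rfl, rfl⟩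

theorem cover_connected (a b : Q.CoverVertex o) :
    Relation.EqvGen (fun a b => ∃ e, (Q.cover o).src e = a ∧ (Q.cover o).tgt e = b) a b := by
  have key : ∀ (w : List (E × Bool)) (j : I) (h : Q.IsWalk o w j),
      Relation.EqvGen (fun a b => ∃ e, (Q.cover o).src e = a ∧ (Q.cover o).tgt e = b)
        (Q.baseVertex o) (ofWalk w h) := by
    intro w
    induction w using List.reverseRecOn with
    | nil =>
      rintro j rfl
      exact Relation.EqvGen.refl _
    | append_singleton w x ih =>
      intro j h
      obtain ⟨k, hk, hx, rfl⟩ := isWalk_append.1 h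
      exact (ih k hk).trans _ _ _ (eqvGen_extend (ofWalk w hk) x hx)
  obtain ⟨w, hw, ha⟩ := exists_ofWalk a
  obtain ⟨w', hw', hb⟩ := exists_ofWalk b
  rw [ha, hb]
  exact ((key w _ hw).symm).trans _ _ _ (key w' _ hw')

/-- Turning around a vertex of the cover projects to turning around a vertex of the quiver. -/
theorem cover_red_blue_inv_pow (k : ℕ) (x : Q.CoverArrow o) :
    ((((Q.cover o).red * (Q.cover o).blue⁻¹) ^ k) x).1 =
      (((Q.red * Q.blue⁻¹) ^ k) x.1.1, x.1.2) := by
  induction k with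
  | zero => rfl
  | succ k ih =>
    have h1 : ∀ y : Q.CoverArrow o, (((Q.cover o).red * (Q.cover o).blue⁻¹) y).1 =
        ((Q.red * Q.blue⁻¹) y.1.1, y.1.2) := by
      intro y
      refine Prod.ext rfl (CoverVertex.extend_extend Q y.1.2 (Q.blue.symm y.1.1, false) ?_ rfl)
      change Q.tgt (Q.blue.symm y.1.1) = _
      rw [← Q.src_blue, Equiv.apply_symm_apply, y.2]
    rw [pow_succ', pow_succ', Equiv.Perm.mul_apply, h1, ih]
    rfl

theorem hasCycleSum_of_sum_eq_two [Fintype E] {σ : Equiv.Perm E} {R : E → ℝ}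
    (h : ∀ F : Quotient (Equiv.Perm.SameCycle.setoid σ),
      ∑ e with Quotient.mk (Equiv.Perm.SameCycle.setoid σ) e = F, R e = 2) :
    HasCycleSum σ R := by
  intro e
  have h0 : 0 < minimalPeriod σ e := by
    refine minimalPeriod_pos_of_mem_periodicPts ⟨orderOf σ, orderOf_pos σ, ?_⟩
    rw [IsPeriodicPt, IsFixedPt, Equiv.Perm.iterate_eq_pow, pow_orderOf_eq_one]
    rfl
  rw [← sum_boundary_toFinset, ← h (cyc σ e)]
  refine Finset.sum_congr ?_ fun _ _ => rfl
  ext f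
  rw [List.mem_toFinset, mem_boundary h0, Finset.mem_filter, Equiv.Perm.sameCycle_comm,
    ← cyc_eq_iff]
  simp

/-- The universal cover of a torus quiver with a non-degenerate `R`-charge is planar. -/
theorem isPlanar_cover [Fintype E] (hQ : Q.IsTorus) {R : E → ℝ} (hR : Q.IsNondegenerateRCharge R)
    (o : I) : (Q.cover o).IsPlanar fun x => R x.1.1 := by
  have hblue : HasCycleSum Q.blue R := hasCycleSum_of_sum_eq_two fun F => by
    convert hR.blue_face F
  have hred : HasCycleSum Q.red R := hasCycleSum_of_sum_eq_two fun F => by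
    convert hR.red_face F
  refine
    { link := fun x x' h => ?_
      connected := cover_connected
      exact := cover_exact hblue.period_pos hred.period_pos
      pos := fun x => hR.pos _
      lt_one := fun x => hR.lt_one _
      blue_sum := hblue.liftPerm (hσ := Q.src_blue) elementary_blue
      red_sum := hred.liftPerm (hσ := Q.src_red) elementary_red
      vertex := fun a => ?_ }
  · have h1 : x.1.2 = x'.1.2 := h
    obtain ⟨k, -, hk⟩ := (hQ.link x.1.1 x'.1.1 (by rw [← x.2, ← x'.2, h1])).exists_pow_eq'
    refine ⟨k, Subtype.ext ?_⟩
    rw [cover_red_blue_inv_pow, hk, h1]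
  · have hO : Injective fun e : {e // Q.src e = a.1} =>
        (⟨(e.1, a), e.2.symm⟩ : Q.CoverArrow o) := fun e e' h =>
      Subtype.ext (Prod.ext_iff.1 (Subtype.ext_iff.1 h)).1
    have hN : Injective fun e : {e // Q.tgt e = a.1} =>
        (⟨(e.1, CoverVertex.extend Q a (e.1, false) e.2), rfl⟩ : Q.CoverArrow o) := fun e e' h =>
      Subtype.ext (Prod.ext_iff.1 (Subtype.ext_iff.1 h)).1
    refine ⟨Finset.univ.map ⟨_, hO⟩, Finset.univ.map ⟨_, hN⟩, fun x => ?_, fun x => ?_, ?_⟩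
    · simp only [Finset.mem_map, Finset.mem_univ, true_and]
      constructor
      · rintro ⟨e, rfl⟩
        rfl
      · rintro rfl
        exact ⟨⟨x.1.1, x.2.symm⟩, rfl⟩
    · simp only [Finset.mem_map, Finset.mem_univ, true_and]
      constructor
      · rintro ⟨e, rfl⟩
        exact CoverVertex.extend_extend Q a (e.1, false) e.2 rfl
      · rintro rfl
        exact ⟨⟨x.1.1, rfl⟩, Subtype.ext (Prod.ext rfl
          (CoverVertex.extend_extend Q x.1.2 (x.1.1, true) x.2.symm rfl))⟩
    · rw [Finset.sum_map, Finset.sum_map, ← hR.vertex a.1]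
      congr 1
      · exact (Finset.sum_subtype _ (by simp) fun e => 1 - R e).symm
      · exact (Finset.sum_subtype _ (by simp) fun e => 1 - R e).symm

end CoverPlanar

end SurfaceQuiver

theorem mainTheorem6 {I : Type u} {E : Type v} [Fintype E] (Q : SurfaceQuiver I E)
    (hQ : Q.IsTorus) (hR : ∃ R : E → ℝ, Q.IsNondegenerateRCharge R) : Q.IsShrubby := by
  obtain ⟨R, hR⟩ := hR
  intro o a b p p' hp hp' hne
  exact (SurfaceQuiver.isPlanar_cover hQ hR o).exists_wheel hp hp' hne
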